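/- **Setting.** Let $F=F_N\circ\dots\circ F_1$, $N\ge 1$, be a generalized Hénon map of $\mathbb C^2$ given by monic and centered polynomials: $F_i(z,w)=(P_i(z)-a_iw,\,z)$ with $a_i\in\mathbb C^*$ and $P_i(z)=z^{d_i}+O(z^{d_i-2})$ a polynomial of degree $d_i\ge 2$. Put $D_i=d_1\cdots d_i$, $D_0=1$, $A=a_1\cdots a_N$. Define polynomials by $Q_0=z$, $Q_1=P_1(z)-a_1w$, $Q_i=P_i(Q_{i-1})-a_iQ_{i-2}$ for $2\le i\le N$, so that $F=(Q_N,Q_{N-1})$, and let $V_i(t,w)=t^{D_i}Q_i\left(\frac1t,\frac wt\right)$, which is a polynomial in $(t,w)$. In the affine coordinates $(t,w)\mapsto[t:1:w]$ at infinity, $F$ is the germ at $(0,0)$ $$\widehat F(t,w)=\left(\frac{t^{D_N}}{V_N(t,w)},\ \frac{t^{D_N-D_{N-1}}V_{N-1}(t,w)}{V_N(t,w)}\right).$$ **The normal form $F^{(3)}$** is obtained in three steps. 1. (Böttcher coordinates.) With $(t_n,w_n)=\widehat F^{\,n}(t,w)$ and principal branches of the roots, put $$\phi(t,w)=\Big(t\prod_{n\ge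 0}V_N(t_n,w_n)^{-1/D_N^{n+1}},\ w\Big),$$ and let $F^{(1)}=\phi\circ\widehat F\circ\phi^{-1}$, a holomorphic germ at the origin. 2. Let $\Psi(x,w)=(x,\,w(1+\psi(x,w)))$, with $\psi$ a holomorphic germ at the origin such that $\psi(0,0)=0$, conjugate $F^{(1)}$ to a germ of the form $$F^{(2)}(x,y)=\left(x^{D_N},\ \tfrac{A}{D_N}\,y\,x^{2D_N-2}+\tilde h(x)\right),$$ that is, $\Psi\circ F^{(1)}=F^{(2)}\circ\Psi$, with $\tilde h$ holomorphic near $0$. 3. Write $\tilde h(x)=\sum_{n\ge1}b_nx^n$ and set $$F^{(3)}(x,y)=\left(x^{D_N},\ \tfrac{A}{D_N}\,y\,x^{2D_N-2}+g(x)\right),\qquad g(x)=\sum_{n=1}^{2D_N-2}b_nx^n+\frac{D_N}{A}\,b_{2D_N-1}x^{D_N}+\tilde b_{2D_N}x^{2D_N},$$ where $\tilde b_{2D_N}=b_{2D_N}$ if $A=D_N$ and $\tilde b_{2D_N}=0$ otherwise. **Proposition.** Each generalized Hénon map $F$ given by monic and centered polynomials has exactly one normal form $F^{(3)}$ in this sense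 (it exists, and it depends neither on the choices in the steps nor on the decomposition of $F$), and the map $F\mapsto F^{(3)}$ on the set of all these maps (with arbitrary $N$ and degrees) is injective: if $F^{(3)}=G^{(3)}$, then $F=G$. -/

import Mathlib

open Polynomial Topology

/-- The data of a standard Hénon map `(z, w) ↦ (P z - a w, z)`: a polynomial `P` and a number `a`. -/
structure HenonFactor where
  P : ℂ[X]
  a : ℂ

namespace HenonFactor

/-- The standard Hénon map `(z, w) ↦ (P z - a w, z)`. -/
def toMap (H : HenonFactor) (p : ℂ × ℂ) : ℂ × ℂ :=
  (H.P.eval p.1 - H.a * p.2, p.1)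

/-- `deg P ≥ 2`, `a ≠ 0`, and `P` is monic and centered: `P z = z ^ d + O (z ^ (d - 2))`. -/
structure IsReduced (H : HenonFactor) : Prop where
  two_le : 2 ≤ H.P.natDegree
  a_ne_zero : H.a ≠ 0
  monic : H.P.Monic
  centered : H.P.coeff (H.P.natDegree - 1) = 0

end HenonFactor

/-! A list `[H_N, …, H_1]` of standard Hénon maps stands for the composition
`F_N ∘ ⋯ ∘ F_1`, the head of the list being applied last. -/

namespace Henon

/-- The composition `F_N ∘ ⋯ ∘ F_1`. -/
def compMap : List HenonFactor → ℂ × ℂ → ℂ × ℂ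
  | [] => id
  | H :: L => H.toMap ∘ compMap L

/-- A non-empty list of standard Hénon maps with monic and centered polynomials. -/
def IsReducedList (L : List HenonFactor) : Prop :=
  L ≠ [] ∧ ∀ H ∈ L, H.IsReduced

/-- `F` is a generalized Hénon map given by monic and centered polynomials. -/
def IsReducedHenon (F : ℂ × ℂ → ℂ × ℂ) : Prop :=
  ∃ L : List HenonFactor, IsReducedList L ∧ compMap L = F

/-- `D_N = d_N ⋯ d_1`, with `D_0 = 1`. -/
noncomputable def deg (L : List HenonFactor) : ℕ :=
  (L.map fun H => H.P.natDegree).prod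

/-- `A = a_N ⋯ a_1`. -/
noncomputable def jac (L : List HenonFactor) : ℂ :=
  (L.map fun H => H.a).prod

/-- The polynomial `Q_N` in the variables `z = X 0`, `w = X 1`, for which
`F_N ∘ ⋯ ∘ F_1 = (Q_N, Q_{N-1})`: one has `Q_0 = z`, `Q_1 = P_1 z - a_1 w` and
`Q_i = P_i (Q_{i-1}) - a_i Q_{i-2}` for `i ≥ 2`. -/
noncomputable def Q : List HenonFactor → MvPolynomial (Fin 2) ℂ
  | [] => MvPolynomial.X 0
  | [H] => aeval (MvPolynomial.X 0 : MvPolynomial (Fin 2) ℂ) H.P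
      - MvPolynomial.C H.a * MvPolynomial.X 1
  | H :: H' :: L => aeval (Q (H' :: L)) H.P - MvPolynomial.C H.a * Q L

/-- The polynomial function `V_N (t, w) = t ^ D_N * Q_N (1 / t, w / t)`, written out over the
monomials `z ^ j w ^ k` of `Q_N` (where `j + k ≤ D_N`), so that it is also defined at `t = 0`. -/
noncomputable def V (L : List HenonFactor) (p : ℂ × ℂ) : ℂ :=
  ∑ m ∈ (Q L).support,
    MvPolynomial.coeff m (Q L) * p.1 ^ (deg L - (m 0 + m 1)) * p.2 ^ (m 1)

/-- The map `F_N ∘ ⋯ ∘ F_1` in the affine coordinates `(t, w) ↦ [t : 1 : w]` centered at the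
point `[0 : 1 : 0]` at infinity, that is, in which `(z, w')` is `(1 / z, w' / z)`:
`(t, w) ↦ (t ^ D_N / V_N, t ^ (D_N - D_{N-1}) V_{N-1} / V_N)`. -/
noncomputable def chartMap (L : List HenonFactor) (p : ℂ × ℂ) : ℂ × ℂ :=
  (p.1 ^ deg L / V L p, p.1 ^ (deg L - deg L.tail) * V L.tail p / V L p)

/-- The Böttcher coordinate
`φ_w t = t * ∏_{n ≥ 0} V_N (t_n, w_n) ^ (-1 / D_N ^ (n + 1))`, where `(t_n, w_n)` is the image of
`(t, w)` under the `n`-th iterate of the map; the powers are principal branches. -/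
noncomputable def bottcherCoord (L : List HenonFactor) (p : ℂ × ℂ) : ℂ :=
  p.1 * ∏' n : ℕ, V L ((chartMap L)^[n] p) ^ (-1 / (deg L : ℂ) ^ (n + 1))

/-- `φ (t, w) = (φ_w t, w)`. -/
noncomputable def bottcher (L : List HenonFactor) (p : ℂ × ℂ) : ℂ × ℂ :=
  (bottcherCoord L p, p.2)

/-- Holomorphy of a germ at the origin of `ℂ²`: complex differentiability in a neighbourhood. -/
def HolomorphicGerm {E : Type*} [NormedAddCommGroup E] [NormedSpace ℂ E] (f : ℂ × ℂ → E) : Prop :=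
  ∀ᶠ p in 𝓝 (0 : ℂ × ℂ), DifferentiableAt ℂ f p

/-- First step: `F₁` is the germ `φ ∘ F ∘ φ⁻¹` at the origin. -/
def IsStepOne (L : List HenonFactor) (F₁ : ℂ × ℂ → ℂ × ℂ) : Prop :=
  HolomorphicGerm F₁ ∧ ∀ᶠ p in 𝓝 (0 : ℂ × ℂ), F₁ (bottcher L p) = bottcher L (chartMap L p)

/-- The map `(x, y) ↦ (x ^ D, (A / D) y x ^ (2 D - 2) + u x)`, the shape of the second and of the
third germ, with `D = D_N`. -/
noncomputable def skewMap (L : List HenonFactor) (u : ℂ → ℂ) (p : ℂ × ℂ) : ℂ × ℂ :=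
  (p.1 ^ deg L, jac L / (deg L : ℂ) * p.2 * p.1 ^ (2 * deg L - 2) + u p.1)

/-- Second step: a holomorphic germ `Ψ (x, w) = (x, w (1 + ψ (x, w)))` with `ψ (0, 0) = 0`
conjugates `F₁` to the germ `F₂ (x, y) = (x ^ D, (A / D) y x ^ (2 D - 2) + h x)`,
that is, `Ψ ∘ F₁ = F₂ ∘ Ψ` near the origin. -/
def IsStepTwo (L : List HenonFactor) (F₁ : ℂ × ℂ → ℂ × ℂ) (h : ℂ → ℂ) : Prop :=
  AnalyticAt ℂ h 0 ∧ ∃ ψ : ℂ × ℂ → ℂ, HolomorphicGerm ψ ∧ ψ 0 = 0 ∧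
    ∀ᶠ p in 𝓝 (0 : ℂ × ℂ),
      ((F₁ p).1, (F₁ p).2 * (1 + ψ (F₁ p))) = skewMap L h (p.1, p.2 * (1 + ψ p))

/-- The Taylor coefficient `b_n` at the origin. -/
noncomputable def taylorCoeff (h : ℂ → ℂ) (n : ℕ) : ℂ :=
  iteratedDeriv n h 0 / (n.factorial : ℂ)

open Classical in
/-- Third step: for `h x = ∑ b_n x ^ n` and `D = D_N`, the polynomial
`g x = ∑_{n = 1}^{2 D - 2} b_n x ^ n + (D / A) b_{2 D - 1} x ^ D + c x ^ (2 D)`,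
where `c = b_{2 D}` if `A = D` and `c = 0` otherwise. -/
noncomputable def stepThree (L : List HenonFactor) (h : ℂ → ℂ) (x : ℂ) : ℂ :=
  (∑ n ∈ Finset.Icc 1 (2 * deg L - 2), taylorCoeff h n * x ^ n)
    + (deg L : ℂ) / jac L * taylorCoeff h (2 * deg L - 1) * x ^ deg L
    + (if jac L = (deg L : ℂ) then taylorCoeff h (2 * deg L) else 0) * x ^ (2 * deg L)

/-- `F₃` is the normal form `F⁽³⁾` of the generalized Hénon map `F`: for a decomposition of `F`
into standard Hénon maps with monic and centered polynomials, it results from the three steps. -/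
def IsNormalForm (F F₃ : ℂ × ℂ → ℂ × ℂ) : Prop :=
  ∃ (L : List HenonFactor) (F₁ : ℂ × ℂ → ℂ × ℂ) (h : ℂ → ℂ),
    IsReducedList L ∧ compMap L = F ∧ IsStepOne L F₁ ∧ IsStepTwo L F₁ h ∧
      F₃ = skewMap L (stepThree L h)

end Henon

/-! ### Holomorphic functions of two variables: Cauchy estimates, series, parameter integrals. -/

section SeveralVariables

open Metric Set MeasureTheory

/-! Existence. At the superattracting point `V = 1 + O(t ^ 2, t w)`, so the logarithm `S` of the
Böttcher product (`logSum`) converges to a holomorphic function, and `x = t exp S` is a coordinate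
tangent to `t`. For the second step, `F` multiplies the form `dz ∧ dw'` by `A`. At infinity this
form is `-t ^ (-3) dt ∧ dw`, which in the coordinates `(x, w)` reads `-x ^ (-3) κ dx ∧ dw` with `κ =
exp (2 S) / (1 + t ∂S/∂t)` (`density`). As `x` goes to `x ^ D`, invariance says that `κ ∘ F₁` times
the `w`-derivative of the second component of `F₁` is `(A / D) x ^ (2 D - 2) κ`. Hence the primitive
`y` of `κ` in `w` makes the germ affine in `y` (`fderiv_chartMap_mul_density`, `exists_steps`).

Independence of choices. For two admissible `Ψ` the ratio of the `w`-derivatives is invariant under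
the germ off `x = 0` and tends to `1` at the origin, to which all nearby orbits converge. So it is
`1`, and `h` is unique (`stepTwo_eventuallyEq`). The decomposition enters only through `Q_N`,
`Q_{N-1}`, their degrees and `A`, which the map determines.

Injectivity. Restrict to the curve `w = 0`, where `y = 0`, parametrized by `x`, and put `E =
D_{N-1}`. There `Q_N = x ^ (-D) + O(x ^ E)` and `h = x ^ D Q_{N-1} + O(x ^ (2 D))`
(`exists_steps_asymptotics`). Since the polynomials are centered, `Q_{N-1} = x ^ (-E) + o(1)`; hence
`b_0 = b_D = 0`, and `g` determines every `b_n` with `n < 2 D`, because only `b_{2D-1}` survives in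
its coefficient of `x ^ D`. Equal normal forms therefore force the two `Q_{N-1}` to agree up to `O(x
^ D)` and the two `Q_N` up to `O(x ^ E)`.

Now insert this into `P_N (Q_{N-1}) = Q_N + a_N Q_{N-2}`. The difference of the two `P_N`, evaluated
at `Q_{N-1}`, has a pole of order less than `E`, so it is a constant. Comparing principal parts,
which carry no constant term, makes this constant zero and identifies the `a_N`. Then the two
`Q_{N-2}` agree up to `O(x ^ E)` and the argument repeats (`eq_of_curveQ`). The coefficient `a_1` is
invisible on `w = 0`; it is recovered from `A`. -/

theorem norm_fderiv_le_of_norm_le {E : Type*} [NormedAddCommGroup E] [NormedSpace ℂ E]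
    {f : E → ℂ} {c : E} {r M : ℝ} (hr : 0 < r) (hf : DifferentiableOn ℂ f (ball c r))
    (hM : ∀ p ∈ ball c r, ‖f p‖ ≤ M) : ‖fderiv ℂ f c‖ ≤ 2 * M / r := by
  refine Complex.norm_fderiv_le_div_of_mapsTo_ball hf (fun p hp => ?_) hr
  rw [mem_closedBall, dist_eq_norm]
  calc ‖f p - f c‖ ≤ ‖f p‖ + ‖f c‖ := norm_sub_le _ _
    _ ≤ 2 * M := by linarith [hM p hp, hM c (mem_ball_self hr)]

/-- Weierstrass: on balls of half the radius the Cauchy estimate turns the summable bounds for the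
functions into summable bounds for their derivatives, so the series may be differentiated termwise.
-/
theorem differentiableOn_tsum_of_norm_le {E : Type*} [NormedAddCommGroup E] [NormedSpace ℂ E]
    {f : ℕ → E → ℂ} {U : Set E} {M : ℕ → ℝ} (hU : IsOpen U) (hM : Summable M)
    (hf : ∀ n, DifferentiableOn ℂ (f n) U) (hb : ∀ n, ∀ p ∈ U, ‖f n p‖ ≤ M n) :
    DifferentiableOn ℂ (fun p => ∑' n, f n p) U := by
  intro c hc
  obtain ⟨r, hr, hrU⟩ := Metric.isOpen_iff.1 hU c hc
  let : NormedSpace ℝ E := NormedSpace.restrictScalars ℝ ℂ E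
  have hsub : ∀ p ∈ ball c (r / 2), ball p (r / 2) ⊆ U := fun p hp =>
    (ball_subset_ball' (by rw [mem_ball] at hp; linarith)).trans hrU
  refine (hasFDerivAt_tsum_of_isPreconnected (𝕜 := ℂ) (s := ball c (r / 2))
    (u := fun n => 2 * M n / (r / 2)) (f' := fun n p => fderiv ℂ (f n) p)
    ((hM.mul_left 2).div_const _) isOpen_ball
    (convex_ball c (r / 2)).isPreconnected
    (fun n p hp => ((hf n).differentiableAt (hU.mem_nhds (hsub p hp (mem_ball_self
      (by positivity))))).hasFDerivAt)
    (fun n p hp => norm_fderiv_le_of_norm_le (by positivity) ((hf n).mono (hsub p hp))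
      fun q hq => hb n q (hsub p hp hq)) (mem_ball_self (by positivity)) ?_
    (mem_ball_self (by positivity))).differentiableAt.differentiableWithinAt
  exact Summable.of_norm_bounded hM fun n => hb n c hc

/-- A holomorphic function of two variables, integrated over a curve of affine substitutions,
depends holomorphically on the point. -/
theorem differentiableAt_integral_comp_affine {f : ℂ × ℂ → ℂ} {U : Set (ℂ × ℂ)} (hU : IsOpen U)
    (hf : DifferentiableOn ℂ f U) {A : ℝ → (ℂ × ℂ) →L[ℂ] (ℂ × ℂ)} {b : ℝ → ℂ × ℂ} {c : ℝ → ℂ}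
    (hA : Continuous A) (hb : Continuous b) (hc : Continuous c) {l m : ℝ} {p₀ : ℂ × ℂ}
    (hp₀ : ∀ θ ∈ uIcc l m, A θ p₀ + b θ ∈ U) :
    DifferentiableAt ℂ (fun p => ∫ θ in l..m, c θ * f (A θ p + b θ)) p₀ := by
  have hcont : Continuous fun θ => A θ p₀ + b θ := (hA.clm_apply continuous_const).add hb
  have hK : IsCompact ((fun θ => A θ p₀ + b θ) '' uIcc l m) := isCompact_uIcc.image hcont
  obtain ⟨δ, hδ, hδU⟩ := hK.exists_cthickening_subset_open hU (by
    rintro _ ⟨θ, hθ, rfl⟩; exact hp₀ θ hθ)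
  obtain ⟨M, hM⟩ := (hK.cthickening (r := δ)).exists_bound_of_continuousOn
    (hf.continuousOn.mono hδU)
  obtain ⟨N, hN⟩ := isCompact_uIcc (a := l) (b := m) |>.exists_bound_of_continuousOn hA.continuousOn
  obtain ⟨C, hC⟩ := isCompact_uIcc (a := l) (b := m) |>.exists_bound_of_continuousOn hc.continuousOn
  have hN0 : 0 ≤ N := (norm_nonneg _).trans (hN l left_mem_uIcc)
  have hC0 : 0 ≤ C := (norm_nonneg _).trans (hC l left_mem_uIcc)
  -- Moving `p` by less than `δ / (2 * (N + 1))` moves the image point by at most `δ / 2`; the other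
  -- half of `δ` is the radius for the Cauchy estimate of `fderiv`.
  have hnear : ∀ θ ∈ uIcc l m, ∀ p ∈ ball p₀ (δ / (2 * (N + 1))),
      ball (A θ p + b θ) (δ / 2) ⊆ cthickening δ ((fun θ => A θ p₀ + b θ) '' uIcc l m) := by
    intro θ hθ p hp q hq
    refine mem_cthickening_of_dist_le q _ δ _ (mem_image_of_mem _ hθ) ?_
    have h1 : dist (A θ p + b θ) (A θ p₀ + b θ) ≤ δ / 2 := by
      rw [dist_add_right, dist_eq_norm, ← map_sub]
      rw [mem_ball, dist_eq_norm] at hp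
      calc ‖A θ (p - p₀)‖ ≤ ‖A θ‖ * ‖p - p₀‖ := (A θ).le_opNorm _
        _ ≤ (N + 1) * (δ / (2 * (N + 1))) := by
          gcongr
          linarith [hN θ hθ]
        _ = δ / 2 := by field_simp
    calc dist q (A θ p₀ + b θ) ≤ dist q (A θ p + b θ) + dist (A θ p + b θ) (A θ p₀ + b θ) :=
          dist_triangle _ _ _
      _ ≤ δ := by rw [mem_ball] at hq; linarith
  have hmem : ∀ θ ∈ uIcc l m, ∀ p ∈ ball p₀ (δ / (2 * (N + 1))), A θ p + b θ ∈ U :=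
    fun θ hθ p hp => hδU (hnear θ hθ p hp (mem_ball_self (by positivity)))
  have hci : ∀ p ∈ ball p₀ (δ / (2 * (N + 1))),
      ContinuousOn (fun θ => c θ * f (A θ p + b θ)) (uIcc l m) := fun p hp =>
    hc.continuousOn.mul (hf.continuousOn.comp
      ((hA.clm_apply continuous_const).add hb).continuousOn fun θ hθ => hmem θ hθ p hp)
  have hball : ball p₀ (δ / (2 * (N + 1))) ∈ 𝓝 p₀ := ball_mem_nhds _ (by positivity)
  refine (intervalIntegral.hasFDerivAt_integral_of_dominated_of_fderiv_le (𝕜 := ℂ)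
    (F' := fun p θ => c θ • (fderiv ℂ f (A θ p + b θ)).comp (A θ))
    (bound := fun _ => C * (2 * M / (δ / 2) * N)) hball ?_ ?_ ?_ ?_ ?_ ?_).differentiableAt
  · filter_upwards [hball] with p hp
    exact ((hci p hp).mono uIoc_subset_uIcc).aestronglyMeasurable measurableSet_uIoc
  · exact (hci p₀ (mem_ball_self (by positivity))).intervalIntegrable
  · refine Measurable.aestronglyMeasurable ?_
    refine hc.measurable.smul ?_
    -- Only measurability of `fderiv` is used: its continuity is deduced later from this very lemma.
    have h1 : Measurable fun θ => fderiv ℂ f (A θ p₀ + b θ) :=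
      (measurable_fderiv ℂ f).comp hcont.measurable
    have h2 : Continuous fun q : ((ℂ × ℂ) →L[ℂ] ℂ) × ((ℂ × ℂ) →L[ℂ] (ℂ × ℂ)) => q.1.comp q.2 := by
      fun_prop
    exact h2.measurable.comp (h1.prodMk hA.measurable)
  · refine Filter.Eventually.of_forall fun θ hθ p hp => ?_
    have hθ' := uIoc_subset_uIcc hθ
    rw [norm_smul]
    gcongr
    · exact hC θ hθ'
    · refine (ContinuousLinearMap.opNorm_comp_le _ _).trans ?_
      have h := norm_fderiv_le_of_norm_le (M := M) (half_pos hδ)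
        (hf.mono ((hnear θ hθ' p hp).trans hδU)) fun q hq => hM q (hnear θ hθ' p hp hq)
      gcongr
      · exact (norm_nonneg _).trans h
      · exact hN θ hθ'
  · simp
  · refine Filter.Eventually.of_forall fun θ hθ p hp => ?_
    have h := (hf.differentiableAt (hU.mem_nhds (hmem θ (uIoc_subset_uIcc hθ) p hp))).hasFDerivAt
    exact (h.comp p ((A θ).hasFDerivAt.add_const (b θ))).const_smul (c θ)

/-- On the complex line through `p` in direction `v`, Cauchy's formula expresses the directional
derivative as a circle integral of translates of `f`, and such an integral is holomorphic in `p`. -/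
theorem differentiableOn_fderiv_apply {f : ℂ × ℂ → ℂ} {U : Set (ℂ × ℂ)} (hU : IsOpen U)
    (hf : DifferentiableOn ℂ f U) (v : ℂ × ℂ) :
    DifferentiableOn ℂ (fun p => fderiv ℂ f p v) U := by
  intro p₀ hp₀
  refine DifferentiableAt.differentiableWithinAt ?_
  obtain ⟨δ, hδ, hδU⟩ := Metric.isOpen_iff.1 hU p₀ hp₀
  set r : ℝ := δ / (2 * (‖v‖ + 1)) with hr
  have hr0 : 0 < r := by positivity
  have hrv : r * ‖v‖ < δ / 2 := by
    rw [hr, div_mul_eq_mul_div, div_lt_div_iff₀ (by positivity) (by positivity)]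
    nlinarith [norm_nonneg v]
  have hmem : ∀ p ∈ ball p₀ (δ / 2), ∀ z : ℂ, ‖z‖ ≤ r → p + z • v ∈ U := by
    intro p hp z hz
    apply hδU
    rw [mem_ball, dist_eq_norm] at hp ⊢
    calc ‖p + z • v - p₀‖ = ‖(p - p₀) + z • v‖ := by rw [add_sub_right_comm]
      _ ≤ ‖p - p₀‖ + ‖z‖ * ‖v‖ := (norm_add_le _ _).trans (by rw [norm_smul])
      _ < δ := by nlinarith [norm_nonneg v]
  have key : ∀ p ∈ ball p₀ (δ / 2), fderiv ℂ f p v = (2 * Real.pi * Complex.I)⁻¹ *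
      ∫ θ in (0 : ℝ)..(2 * Real.pi), (deriv (circleMap 0 r) θ * (1 / circleMap 0 r θ ^ 2)) *
        f (ContinuousLinearMap.id ℂ (ℂ × ℂ) p + circleMap 0 r θ • v) := by
    intro p hp
    have hd : DifferentiableOn ℂ (fun z : ℂ => f (p + z • v)) (closedBall 0 r) := by
      intro z hz
      refine DifferentiableAt.differentiableWithinAt ?_
      have := hf.differentiableAt (hU.mem_nhds (hmem p hp z (by simpa using hz)))
      exact DifferentiableAt.comp z this (by fun_prop)
    have h0 : HasDerivAt (fun z : ℂ => f (p + z • v)) (fderiv ℂ f p v) 0 := by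
      have h1 : HasFDerivAt f (fderiv ℂ f p) (p + (0 : ℂ) • v) := by
        simpa using (hf.differentiableAt (hU.mem_nhds
          (by simpa using hmem p hp 0 (by simpa using hr0.le)))).hasFDerivAt
      have h2 : HasDerivAt (fun z : ℂ => p + z • v) ((1 : ℂ) • v) 0 :=
        ((hasDerivAt_id (0 : ℂ)).smul_const v).const_add p
      rw [one_smul] at h2
      exact h1.comp_hasDerivAt (0 : ℂ) h2
    have h := hd.deriv_eq_smul_circleIntegral hr0
    rw [h0.deriv, smul_eq_mul] at h
    rw [eq_inv_mul_iff_mul_eq₀ Complex.two_pi_I_ne_zero, ← h, circleIntegral]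
    refine intervalIntegral.integral_congr fun θ _ => ?_
    simp [mul_assoc]
  have hcirc : ∀ θ, circleMap 0 r θ ≠ 0 := fun θ => circleMap_ne_center hr0.ne'
  have hint : DifferentiableAt ℂ (fun p => ∫ θ in (0 : ℝ)..(2 * Real.pi),
      (deriv (circleMap 0 r) θ * (1 / circleMap 0 r θ ^ 2)) *
        f (ContinuousLinearMap.id ℂ (ℂ × ℂ) p + circleMap 0 r θ • v)) p₀ := by
    refine differentiableAt_integral_comp_affine hU hf
      (A := fun _ => ContinuousLinearMap.id ℂ (ℂ × ℂ)) (b := fun θ => circleMap 0 r θ • v)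
      (c := fun θ => deriv (circleMap 0 r) θ * (1 / circleMap 0 r θ ^ 2))
      continuous_const (by fun_prop) ?_ ?_
    · have : Continuous (circleMap 0 r) := continuous_circleMap 0 r
      simp only [deriv_circleMap]
      exact (this.mul continuous_const).mul
        (continuous_const.div (this.pow 2) fun θ => pow_ne_zero 2 (hcirc θ))
    · intro θ _
      exact hmem p₀ (mem_ball_self (by positivity)) _ (by simp [abs_of_pos hr0])
  refine (hint.const_mul (2 * Real.pi * Complex.I)⁻¹).congr_of_eventuallyEq ?_
  filter_upwards [ball_mem_nhds p₀ (half_pos hδ)] with p hp using key p hp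

end SeveralVariables

/-! ### Algebra of the polynomials `Q` and of the functions `V`. -/

namespace Henon

/-- All the factors of a list are reduced; the list may be empty. -/
def AllReduced (L : List HenonFactor) : Prop := ∀ H ∈ L, H.IsReduced

theorem AllReduced.tail {H : HenonFactor} {L : List HenonFactor} (h : AllReduced (H :: L)) :
    AllReduced L := fun K hK => h K (List.mem_cons_of_mem _ hK)

theorem AllReduced.head {H : HenonFactor} {L : List HenonFactor} (h : AllReduced (H :: L)) :
    H.IsReduced := h H List.mem_cons_self

theorem deg_cons (H : HenonFactor) (L : List HenonFactor) :
    deg (H :: L) = H.P.natDegree * deg L := by simp [deg]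

@[simp] theorem deg_nil : deg [] = 1 := by simp [deg]

theorem jac_cons (H : HenonFactor) (L : List HenonFactor) : jac (H :: L) = H.a * jac L := by
  simp [jac]

theorem deg_pos {L : List HenonFactor} (h : AllReduced L) : 0 < deg L := by
  induction L with
  | nil => simp
  | cons H L ih =>
    rw [deg_cons]
    exact Nat.mul_pos (by have := h.head.two_le; omega) (ih h.tail)

theorem two_mul_deg_tail_le {L : List HenonFactor} (hL : L ≠ []) (h : AllReduced L) :
    2 * deg L.tail ≤ deg L := by
  cases L with
  | nil => exact absurd rfl hL
  | cons H L =>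
    rw [deg_cons, List.tail_cons]
    exact Nat.mul_le_mul_right _ h.head.two_le

theorem jac_ne_zero {L : List HenonFactor} (h : AllReduced L) : jac L ≠ 0 := by
  induction L with
  | nil => simp [jac]
  | cons H L ih =>
    rw [jac_cons]
    exact mul_ne_zero h.head.a_ne_zero (ih h.tail)

/-- The value at `p` of a polynomial in two variables. -/
noncomputable def ev (p : ℂ × ℂ) (q : MvPolynomial (Fin 2) ℂ) : ℂ :=
  MvPolynomial.eval ![p.1, p.2] q

theorem ev_aeval (p : ℂ × ℂ) (q : MvPolynomial (Fin 2) ℂ) (P : ℂ[X]) :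
    ev p (aeval q P) = P.eval (ev p q) := by
  rw [ev, ev, Polynomial.aeval_def, Polynomial.hom_eval₂, Polynomial.eval,
    show (MvPolynomial.eval ![p.1, p.2]).comp (algebraMap ℂ (MvPolynomial (Fin 2) ℂ))
      = RingHom.id ℂ from RingHom.ext fun x => by simp [MvPolynomial.algebraMap_eq]]

theorem ev_Q_nil (p : ℂ × ℂ) : ev p (Q []) = p.1 := by simp [ev, Q]

theorem ev_Q_singleton (p : ℂ × ℂ) (H : HenonFactor) :
    ev p (Q [H]) = H.P.eval p.1 - H.a * p.2 := by
  have h := ev_aeval p (MvPolynomial.X 0) H.P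
  have h0 : ev p (MvPolynomial.X 0) = p.1 := by simp [ev]
  rw [h0] at h
  rw [Q, ← h]
  simp [ev]

theorem ev_Q_cons (p : ℂ × ℂ) (H H' : HenonFactor) (L : List HenonFactor) :
    ev p (Q (H :: H' :: L)) = H.P.eval (ev p (Q (H' :: L))) - H.a * ev p (Q L) := by
  rw [Q, ← ev_aeval]
  simp [ev]

theorem compMap_eq {L : List HenonFactor} (hL : L ≠ []) (p : ℂ × ℂ) :
    compMap L p = (ev p (Q L), ev p (Q L.tail)) := by
  induction L with
  | nil => exact absurd rfl hL
  | cons H L ih =>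
    cases L with
    | nil => simp [compMap, HenonFactor.toMap, ev_Q_singleton, ev_Q_nil]
    | cons H' L =>
      have := ih (by simp)
      rw [compMap, Function.comp_apply, this, HenonFactor.toMap, ev_Q_cons]
      simp

theorem eq_of_forall_ev_eq {q r : MvPolynomial (Fin 2) ℂ} (h : ∀ p, ev p q = ev p r) : q = r := by
  refine MvPolynomial.funext fun x => ?_
  have := h (x 0, x 1)
  have hx : ![x 0, x 1] = x := by
    ext i
    fin_cases i <;> rfl
  simpa [ev, hx] using this

open MvPolynomial in
/-- The Jacobian determinant of `F_N ∘ ⋯ ∘ F_1`. -/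
theorem jacobian_Q {L : List HenonFactor} (hL : L ≠ []) :
    pderiv 0 (Q L) * pderiv 1 (Q L.tail) - pderiv 1 (Q L) * pderiv 0 (Q L.tail) = MvPolynomial.C (jac L) := by
  induction L with
  | nil => exact absurd rfl hL
  | cons H L ih =>
    cases L with
    | nil =>
      simp [Q, jac, Derivation.map_aeval]
    | cons H' L =>
      have := ih (by simp)
      rw [jac_cons, MvPolynomial.C_mul, ← this]
      simp only [Q, List.tail_cons, map_sub, Derivation.map_aeval, Derivation.leibniz, pderiv_C,
        smul_eq_mul, mul_zero, add_zero]
      ring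

/-- This bound makes the truncated subtraction in the exponents of `V` an honest one. -/
theorem totalDegree_Q_le {L : List HenonFactor} (h : AllReduced L) :
    (Q L).totalDegree ≤ deg L := by
  have haev : ∀ (P : ℂ[X]) (q : MvPolynomial (Fin 2) ℂ) (n : ℕ), q.totalDegree ≤ n →
      (aeval q P).totalDegree ≤ P.natDegree * n := by
    intro P q n hq
    rw [Polynomial.aeval_eq_sum_range]
    refine MvPolynomial.totalDegree_finsetSum_le fun i hi => ?_
    refine (MvPolynomial.totalDegree_smul_le _ _).trans ?_
    refine (MvPolynomial.totalDegree_pow _ _).trans ?_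
    exact Nat.mul_le_mul (Nat.lt_succ_iff.1 (Finset.mem_range.1 hi)) hq
  have hC : ∀ (a : ℂ) (q : MvPolynomial (Fin 2) ℂ),
      (MvPolynomial.C a * q).totalDegree ≤ q.totalDegree := by
    intro a q
    rw [← MvPolynomial.smul_eq_C_mul]
    exact MvPolynomial.totalDegree_smul_le _ _
  induction L using List.twoStepInduction with
  | nil => simp [Q, MvPolynomial.totalDegree_X]
  | singleton H =>
    rw [deg_cons, deg_nil]
    refine (MvPolynomial.totalDegree_sub _ _).trans (max_le (haev _ _ 1 ?_) ((hC _ _).trans ?_))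
    · simp [MvPolynomial.totalDegree_X]
    · rw [MvPolynomial.totalDegree_X]
      have := h.head.two_le
      omega
  | cons_cons H H' L ih1 ih2 =>
    rw [deg_cons]
    refine (MvPolynomial.totalDegree_sub _ _).trans
      (max_le (haev _ _ _ (ih2 _ h.tail)) ((hC _ _).trans ((ih1 h.tail.tail).trans ?_)))
    rw [deg_cons]
    have h1 := h.head.two_le
    have h2 := h.tail.head.two_le
    nlinarith [Nat.zero_le (deg L), Nat.mul_le_mul h1 h2]

theorem V_eq {L : List HenonFactor} (h : AllReduced L) {p : ℂ × ℂ} (hp : p.1 ≠ 0) :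
    V L p = p.1 ^ deg L * ev (1 / p.1, p.2 / p.1) (Q L) := by
  rw [V, ev, MvPolynomial.eval_eq', Finset.mul_sum]
  refine Finset.sum_congr rfl fun m hm => ?_
  have hdeg : m 0 + m 1 ≤ deg L := by
    refine le_trans ?_ ((MvPolynomial.le_totalDegree hm).trans (totalDegree_Q_le h))
    rw [Finsupp.sum_fintype _ _ (by simp)]
    simp
  obtain ⟨k, hk⟩ := Nat.exists_eq_add_of_le hdeg
  rw [hk, Nat.add_sub_cancel_left]
  simp only [Fin.prod_univ_two, Matrix.cons_val_zero, Matrix.cons_val_one, div_pow, one_pow]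
  field_simp
  ring

theorem differentiable_V (L : List HenonFactor) : Differentiable ℂ (V L) := by
  unfold V
  fun_prop

/-- Identities for `V` are verified where `t ≠ 0`, through `Q (1 / t, w / t)`, and reach the line `t
= 0` by density. -/
theorem eq_of_forall_fst_ne_zero {f g : ℂ × ℂ → ℂ} (hf : Continuous f) (hg : Continuous g)
    (h : ∀ p : ℂ × ℂ, p.1 ≠ 0 → f p = g p) (p : ℂ × ℂ) : f p = g p := by
  have hd : Dense (Prod.fst ⁻¹' ({(0 : ℂ)}ᶜ) : Set (ℂ × ℂ)) :=
    (dense_compl_singleton (0 : ℂ)).preimage isOpenMap_fst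
  exact congrFun (Continuous.ext_on hd hf hg fun p hp => h p hp) p

theorem V_nil (p : ℂ × ℂ) : V [] p = 1 := by
  refine eq_of_forall_fst_ne_zero (differentiable_V _).continuous continuous_const (fun p hp => ?_) p
  rw [V_eq (by simp [AllReduced]) hp, ev_Q_nil]
  simp [hp]

/-- A monic centered polynomial, homogenized. -/
theorem HenonFactor.IsReduced.eval_eq {H : HenonFactor} (h : H.IsReduced) (x : ℂ) :
    H.P.eval x = x ^ H.P.natDegree
      + ∑ k ∈ Finset.range (H.P.natDegree - 1), H.P.coeff k * x ^ k := by
  obtain ⟨d, hd⟩ := Nat.exists_eq_add_of_le h.two_le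
  have hm := h.monic
  have hc := h.centered
  rw [Polynomial.Monic, Polynomial.leadingCoeff, hd] at hm
  rw [hd] at hc
  rw [Polynomial.eval_eq_sum_range, hd, Finset.sum_range_succ, hm, show 2 + d = d + 1 + 1 by ring,
    Finset.sum_range_succ, show d + 1 + 1 - 1 = d + 1 from rfl]
  rw [show 2 + d - 1 = d + 1 by omega] at hc
  rw [hc]
  ring

/-- Centeredness removes the term linear in `s`; this is the source of the factor `s ^ 2`. -/
theorem HenonFactor.IsReduced.homogenized_eval {H : HenonFactor} (h : H.IsReduced) {s : ℂ}
    (hs : s ≠ 0) (v : ℂ) :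
    s ^ H.P.natDegree * H.P.eval (v / s) = v ^ H.P.natDegree
      + s ^ 2 * ∑ k ∈ Finset.range (H.P.natDegree - 1),
        H.P.coeff k * s ^ (H.P.natDegree - 2 - k) * v ^ k := by
  rw [HenonFactor.IsReduced.eval_eq h, mul_add, Finset.mul_sum, Finset.mul_sum]
  congr 1
  · rw [← mul_pow, mul_div_cancel₀ _ hs]
  · refine Finset.sum_congr rfl fun k hk => ?_
    have h2 := h.two_le
    have hk' := Finset.mem_range.1 hk
    obtain ⟨e, he⟩ := Nat.exists_eq_add_of_le (show k + 2 ≤ H.P.natDegree by omega)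
    rw [he, show k + 2 + e - 2 - k = e by omega, div_pow]
    field_simp
    ring

/-- `V = 1 + O (t ^ 2, t w)`. -/
theorem exists_V_eq {L : List HenonFactor} (h : AllReduced L) :
    ∃ a b : ℂ × ℂ → ℂ, Continuous a ∧ Continuous b ∧
      ∀ p, V L p = 1 + p.1 * (p.1 * a p + p.2 * b p) := by
  induction L using List.twoStepInduction with
  | nil => exact ⟨0, 0, continuous_zero, continuous_zero, fun p => by simp [V_nil]⟩
  | singleton H =>
    refine ⟨fun p => ∑ k ∈ Finset.range (H.P.natDegree - 1),
        H.P.coeff k * p.1 ^ (H.P.natDegree - 2 - k) * 1 ^ k,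
      fun p => -H.a * p.1 ^ (H.P.natDegree - 2), by fun_prop, by fun_prop,
      eq_of_forall_fst_ne_zero (differentiable_V _).continuous ?_ fun p hp => ?_⟩
    · fun_prop
    rw [V_eq h hp, ev_Q_singleton, mul_sub, deg_cons, deg_nil, mul_one,
      HenonFactor.IsReduced.homogenized_eval h.head hp]
    obtain ⟨d, hd⟩ := Nat.exists_eq_add_of_le h.head.two_le
    rw [hd]
    simp only [add_tsub_cancel_left, one_pow, mul_one]
    field_simp
    ring
  | cons_cons H H' L ih1 ih2 =>
    obtain ⟨a, b, ha, hb, hab⟩ := ih2 H' h.tail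
    obtain ⟨E, hE⟩ : ∃ E, deg (H' :: L) = E + 1 :=
      Nat.exists_eq_add_of_le' (deg_pos h.tail)
    -- The term `a_N Q_{N-2}` contributes `t ^ (D_N - D_{N-2}) V_{N-2}`, so the exponent must be at
    -- least `2` for it to be absorbed in `t ^ 2 * a`.
    obtain ⟨G, hG⟩ : ∃ G, deg (H :: H' :: L) = deg L + 2 + G := by
      apply Nat.exists_eq_add_of_le
      have h1 := two_mul_deg_tail_le (by simp) h
      have h2 := two_mul_deg_tail_le (by simp) h.tail
      have h3 := deg_pos h.tail.tail
      simp only [List.tail_cons] at h1 h2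
      omega
    -- With `v = V_{N-1}`, the identity `v ^ d - 1 = (v - 1) ∑ v ^ i` transports the induction
    -- hypothesis; with `s = t ^ (E + 1)`, the factor `s ^ 2` leaves `(t ^ E) ^ 2` once `t ^ 2` is
    -- taken out.
    refine ⟨fun p => (∑ i ∈ Finset.range H.P.natDegree, V (H' :: L) p ^ i) * a p
        + (p.1 ^ E) ^ 2 * (∑ k ∈ Finset.range (H.P.natDegree - 1),
        H.P.coeff k * (p.1 ^ (E + 1)) ^ (H.P.natDegree - 2 - k) * V (H' :: L) p ^ k)
        - H.a * p.1 ^ G * V L p,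
      fun p => (∑ i ∈ Finset.range H.P.natDegree, V (H' :: L) p ^ i) * b p, ?_, ?_,
      eq_of_forall_fst_ne_zero (differentiable_V _).continuous ?_ fun p hp => ?_⟩
    · have h1 := (differentiable_V (H' :: L)).continuous
      have h2 := (differentiable_V L).continuous
      fun_prop
    · have h1 := (differentiable_V (H' :: L)).continuous
      fun_prop
    · have h1 := (differentiable_V (H' :: L)).continuous
      have h2 := (differentiable_V L).continuous
      fun_prop
    have e1 : ev (1 / p.1, p.2 / p.1) (Q (H' :: L)) = V (H' :: L) p / p.1 ^ (E + 1) := by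
      rw [V_eq h.tail hp, hE]
      field_simp
    have e2 : p.1 ^ (deg L) * ev (1 / p.1, p.2 / p.1) (Q L) = V L p := (V_eq h.tail.tail hp).symm
    have e3 := HenonFactor.IsReduced.homogenized_eval h.head (pow_ne_zero (E + 1) hp)
      (V (H' :: L) p)
    have e4 := geom_sum_mul (V (H' :: L) p) H.P.natDegree
    have e5 : V (H' :: L) p - 1 = p.1 * (p.1 * a p + p.2 * b p) := by rw [hab p]; ring
    rw [V_eq h hp, ev_Q_cons, mul_sub, e1]
    nth_rewrite 1 [deg_cons]
    rw [hE, mul_comm H.P.natDegree, pow_mul, e3, hG]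
    rw [e5] at e4
    simp only [← e2]
    linear_combination (-1 : ℂ) * e4

theorem V_zero {L : List HenonFactor} (h : AllReduced L) (w : ℂ) : V L (0, w) = 1 := by
  obtain ⟨a, b, -, -, hab⟩ := exists_V_eq h
  simp [hab]

end Henon

/-! ### Attracting polydiscs and convergence of the Böttcher product. -/

namespace Henon

open Filter

/-- Polydiscs that are mapped into themselves near the superattracting point. -/
def polydisc (δ : ℝ) : Set (ℂ × ℂ) := {p | ‖p.1‖ < δ ∧ ‖p.2‖ < 8 * δ}

theorem isOpen_polydisc (δ : ℝ) : IsOpen (polydisc δ) :=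
  (isOpen_lt (f := fun p : ℂ × ℂ => ‖p.1‖) (by fun_prop) continuous_const).inter
    (isOpen_lt (f := fun p : ℂ × ℂ => ‖p.2‖) (by fun_prop) continuous_const)

theorem polydisc_mem_nhds {δ : ℝ} (hδ : 0 < δ) : polydisc δ ∈ 𝓝 (0 : ℂ × ℂ) :=
  (isOpen_polydisc δ).mem_nhds ⟨by simpa using hδ, by simpa using hδ⟩

theorem polydisc_mono {δ ε : ℝ} (h : δ ≤ ε) : polydisc δ ⊆ polydisc ε := fun p hp =>
  ⟨hp.1.trans_le h, hp.2.trans_le (by linarith)⟩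

theorem exists_polydisc_of_eventually {P : ℂ × ℂ → Prop} (h : ∀ᶠ p in 𝓝 0, P p) :
    ∃ δ > 0, ∀ p ∈ polydisc δ, P p := by
  obtain ⟨ε, hε, hP⟩ := Metric.eventually_nhds_iff.1 h
  refine ⟨ε / 8, by positivity, fun p hp => hP ?_⟩
  rw [dist_zero_right, Prod.norm_def]
  exact max_lt (by linarith [hp.1]) (by linarith [hp.2])

/-- On the polydisc of radius `δ`, `V` is near `1` and the germ at infinity is contracting. -/
structure IsAttracting (L : List HenonFactor) (C δ : ℝ) : Prop where
  pos : 0 < δ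
  le : δ ≤ 1 / 4
  const_pos : 0 < C
  V_sub_le : ∀ p ∈ polydisc δ, ‖V L p - 1‖ ≤ C * (‖p.1‖ * (‖p.1‖ + ‖p.2‖))
  V_sub_le_half : ∀ p ∈ polydisc δ, ‖V L p - 1‖ ≤ 1 / 2
  fst_le : ∀ p ∈ polydisc δ, ‖(chartMap L p).1‖ ≤ 2 * ‖p.1‖ ^ deg L
  snd_le : ∀ p ∈ polydisc δ, ‖(chartMap L p).2‖ ≤ 4 * ‖p.1‖ ^ (deg L - deg L.tail)

theorem IsAttracting.mono {L : List HenonFactor} {C δ ε : ℝ} (h : IsAttracting L C δ)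
    (hε : 0 < ε) (hεδ : ε ≤ δ) : IsAttracting L C ε where
  pos := hε
  le := hεδ.trans h.le
  const_pos := h.const_pos
  V_sub_le p hp := h.V_sub_le p (polydisc_mono hεδ hp)
  V_sub_le_half p hp := h.V_sub_le_half p (polydisc_mono hεδ hp)
  fst_le p hp := h.fst_le p (polydisc_mono hεδ hp)
  snd_le p hp := h.snd_le p (polydisc_mono hεδ hp)

theorem AllReduced.tail' {L : List HenonFactor} (h : AllReduced L) : AllReduced L.tail :=
  fun K hK => h K (List.mem_of_mem_tail hK)

theorem exists_isAttracting {L : List HenonFactor} (h : AllReduced L) :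
    ∃ C δ, IsAttracting L C δ := by
  obtain ⟨a, b, ha, hb, hab⟩ := exists_V_eq h
  have hVc := (differentiable_V L).continuous
  have hVc' := (differentiable_V L.tail).continuous
  have e1 : ∀ᶠ p in 𝓝 (0 : ℂ × ℂ), ‖a p‖ < ‖a 0‖ + 1 :=
    ha.norm.continuousAt.eventually_lt continuousAt_const (by simp)
  have e2 : ∀ᶠ p in 𝓝 (0 : ℂ × ℂ), ‖b p‖ < ‖b 0‖ + 1 :=
    hb.norm.continuousAt.eventually_lt continuousAt_const (by simp)
  have e3 : ∀ᶠ p in 𝓝 (0 : ℂ × ℂ), ‖V L p - 1‖ < 1 / 2 :=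
    (hVc.sub continuous_const).norm.continuousAt.eventually_lt continuousAt_const
      (by have := V_zero h 0; simp only [Prod.mk_zero_zero] at this; simp [this])
  have e4 : ∀ᶠ p in 𝓝 (0 : ℂ × ℂ), ‖V L.tail p‖ < 2 :=
    hVc'.norm.continuousAt.eventually_lt continuousAt_const
      (by have := V_zero h.tail' 0; simp only [Prod.mk_zero_zero] at this; simp [this])
  obtain ⟨δ, hδ, hP⟩ := exists_polydisc_of_eventually (e1.and (e2.and (e3.and e4)))
  have hδ' : ∀ p ∈ polydisc (min δ (1 / 4)), p ∈ polydisc δ :=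
    fun p hp => polydisc_mono (min_le_left _ _) hp
  have hVl : ∀ p ∈ polydisc (min δ (1 / 4)), 1 / 2 ≤ ‖V L p‖ := fun p hp => by
    have h1 := (hP p (hδ' p hp)).2.2.1
    have h2 := norm_sub_norm_le (1 : ℂ) (V L p)
    rw [norm_one, norm_sub_rev] at h2
    linarith
  refine ⟨max (‖a 0‖ + 1) (‖b 0‖ + 1), min δ (1 / 4), lt_min hδ (by norm_num), min_le_right _ _,
    lt_max_of_lt_left (by positivity), fun p hp => ?_, fun p hp => (hP p (hδ' p hp)).2.2.1.le,
    fun p hp => ?_, fun p hp => ?_⟩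
  · obtain ⟨h1, h2, -⟩ := hP p (hδ' p hp)
    rw [hab p, add_sub_cancel_left, norm_mul]
    calc ‖p.1‖ * ‖p.1 * a p + p.2 * b p‖ ≤ ‖p.1‖ * (‖p.1‖ * ‖a p‖ + ‖p.2‖ * ‖b p‖) := by
          gcongr
          exact (norm_add_le _ _).trans (by rw [norm_mul, norm_mul])
      _ ≤ ‖p.1‖ * (‖p.1‖ * max (‖a 0‖ + 1) (‖b 0‖ + 1)
          + ‖p.2‖ * max (‖a 0‖ + 1) (‖b 0‖ + 1)) := by
          gcongr
          · exact h1.le.trans (le_max_left _ _)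
          · exact h2.le.trans (le_max_right _ _)
      _ = _ := by ring
  · rw [chartMap, norm_div, norm_pow, div_le_iff₀ (by linarith [hVl p hp])]
    have : 0 ≤ ‖p.1‖ ^ deg L := by positivity
    nlinarith [hVl p hp]
  · rw [chartMap, norm_div, norm_mul, norm_pow, div_le_iff₀ (by linarith [hVl p hp])]
    have h1 : 0 ≤ ‖p.1‖ ^ (deg L - deg L.tail) := by positivity
    have h2 := (hP p (hδ' p hp)).2.2.2
    calc ‖p.1‖ ^ (deg L - deg L.tail) * ‖V L.tail p‖ ≤ ‖p.1‖ ^ (deg L - deg L.tail) * 2 := by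
          gcongr
      _ ≤ _ := by nlinarith [hVl p hp]

namespace IsAttracting

variable {L : List HenonFactor} {C δ : ℝ}

theorem V_ne_zero (h : IsAttracting L C δ) {p : ℂ × ℂ} (hp : p ∈ polydisc δ) : V L p ≠ 0 := by
  intro h0
  have := h.V_sub_le_half p hp
  rw [h0] at this
  norm_num at this

theorem fst_le_half (h : IsAttracting L C δ) (hD : 2 ≤ deg L) {p : ℂ × ℂ} (hp : p ∈ polydisc δ) :
    ‖(chartMap L p).1‖ ≤ ‖p.1‖ / 2 := by
  have h1 := hp.1
  have h2 := h.le
  have h3 := norm_nonneg p.1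
  calc ‖(chartMap L p).1‖ ≤ 2 * ‖p.1‖ ^ deg L := h.fst_le p hp
    _ ≤ 2 * ‖p.1‖ ^ 2 := by
      gcongr 2 * ?_
      exact pow_le_pow_of_le_one h3 (by linarith) hD
    _ ≤ ‖p.1‖ / 2 := by nlinarith

theorem snd_le_four (h : IsAttracting L C δ) (hE : deg L.tail < deg L) {p : ℂ × ℂ}
    (hp : p ∈ polydisc δ) : ‖(chartMap L p).2‖ ≤ 4 * ‖p.1‖ := by
  have h1 := hp.1
  have h2 := h.le
  refine (h.snd_le p hp).trans ?_
  gcongr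
  exact pow_le_of_le_one (norm_nonneg _) (by linarith) (by omega)

/-- The second radius `8 δ` of the polydisc leaves room for the bound `4 ‖t‖` on the second
component. -/
theorem chartMap_mem (h : IsAttracting L C δ) (hD : 2 ≤ deg L) (hE : deg L.tail < deg L)
    {p : ℂ × ℂ} (hp : p ∈ polydisc δ) : chartMap L p ∈ polydisc δ := by
  have h1 := h.fst_le_half hD hp
  have h2 := h.snd_le_four hE hp
  have h3 := hp.1
  have h4 := norm_nonneg p.1
  exact ⟨by linarith, by linarith⟩

theorem iterate_mem (h : IsAttracting L C δ) (hD : 2 ≤ deg L) (hE : deg L.tail < deg L)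
    {p : ℂ × ℂ} (hp : p ∈ polydisc δ) (n : ℕ) : (chartMap L)^[n] p ∈ polydisc δ := by
  induction n with
  | zero => exact hp
  | succ n ih =>
    rw [Function.iterate_succ_apply']
    exact h.chartMap_mem hD hE ih

theorem norm_iterate_fst_le (h : IsAttracting L C δ) (hD : 2 ≤ deg L) (hE : deg L.tail < deg L)
    {p : ℂ × ℂ} (hp : p ∈ polydisc δ) (n : ℕ) :
    ‖((chartMap L)^[n] p).1‖ ≤ ‖p.1‖ * (1 / 2) ^ n := by
  induction n with
  | zero => simp
  | succ n ih =>
    rw [Function.iterate_succ_apply']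
    have := h.fst_le_half hD (h.iterate_mem hD hE hp n)
    rw [pow_succ]
    linarith

theorem tendsto_iterate (h : IsAttracting L C δ) (hD : 2 ≤ deg L) (hE : deg L.tail < deg L)
    {p : ℂ × ℂ} (hp : p ∈ polydisc δ) :
    Tendsto (fun n => (chartMap L)^[n] p) atTop (𝓝 0) := by
  have h0 : Tendsto (fun n : ℕ => ‖p.1‖ * (1 / 2 : ℝ) ^ n) atTop (𝓝 0) := by
    simpa using (tendsto_pow_atTop_nhds_zero_of_lt_one (r := (1 / 2 : ℝ)) (by norm_num)
      (by norm_num)).const_mul ‖p.1‖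
  have h1 : Tendsto (fun n => ((chartMap L)^[n] p).1) atTop (𝓝 0) :=
    squeeze_zero_norm (h.norm_iterate_fst_le hD hE hp) h0
  -- The second component is controlled by the first only after one application of the map, hence
  -- the shift by one.
  have h2 : Tendsto (fun n => ((chartMap L)^[n + 1] p).2) atTop (𝓝 0) := by
    refine squeeze_zero_norm (a := fun n => 4 * ‖((chartMap L)^[n] p).1‖) (fun n => ?_) ?_
    · rw [Function.iterate_succ_apply']
      exact h.snd_le_four hE (h.iterate_mem hD hE hp n)
    · simpa using h1.norm.const_mul 4
  rw [Prod.zero_eq_mk]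
  exact h1.prodMk_nhds ((tendsto_add_atTop_iff_nat 1).1 h2)

theorem chartMap_fst_ne_zero (h : IsAttracting L C δ) {p : ℂ × ℂ} (hp : p ∈ polydisc δ)
    (hp1 : p.1 ≠ 0) : (chartMap L p).1 ≠ 0 :=
  div_ne_zero (pow_ne_zero _ hp1) (h.V_ne_zero hp)

theorem differentiableOn_chartMap (h : IsAttracting L C δ) :
    DifferentiableOn ℂ (chartMap L) (polydisc δ) := by
  have h1 := (differentiable_V L).differentiableOn (s := polydisc δ)
  have h2 := (differentiable_V L.tail).differentiableOn (s := polydisc δ)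
  have h3 := h1.fun_inv fun p hp => h.V_ne_zero hp
  unfold chartMap
  simp only [div_eq_mul_inv]
  fun_prop

end IsAttracting

/-- The logarithm of the infinite product in the Böttcher coordinate. -/
noncomputable def logSum (L : List HenonFactor) (p : ℂ × ℂ) : ℂ :=
  ∑' n : ℕ, Complex.log (V L ((chartMap L)^[n] p)) * (-1 / (deg L : ℂ) ^ (n + 1))

namespace IsAttracting

variable {L : List HenonFactor} {C δ : ℝ}

theorem norm_log_V_le (h : IsAttracting L C δ) {p : ℂ × ℂ} (hp : p ∈ polydisc δ) :
    ‖Complex.log (V L p)‖ ≤ 3 / 2 * ‖V L p - 1‖ := by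
  simpa using Complex.norm_log_one_add_half_le_self (h.V_sub_le_half p hp)

theorem norm_weight_le (hD : 2 ≤ deg L) (n : ℕ) :
    ‖-1 / (deg L : ℂ) ^ (n + 1)‖ ≤ (1 / 2) ^ (n + 1) := by
  rw [norm_div, norm_neg, norm_one, norm_pow, Complex.norm_natCast, div_pow, one_pow]
  gcongr
  exact_mod_cast hD

theorem norm_term_le (h : IsAttracting L C δ) (hD : 2 ≤ deg L) (hE : deg L.tail < deg L)
    {p : ℂ × ℂ} (hp : p ∈ polydisc δ) (n : ℕ) :
    ‖Complex.log (V L ((chartMap L)^[n] p)) * (-1 / (deg L : ℂ) ^ (n + 1))‖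
      ≤ (4 * C * ‖p.1‖) * (1 / 2) ^ (n + 1) := by
  have hm := h.iterate_mem hD hE hp n
  rw [norm_mul]
  refine mul_le_mul ?_ (norm_weight_le hD n) (norm_nonneg _) (by have := h.const_pos; positivity)
  have h1 := h.norm_log_V_le hm
  have h2 := h.V_sub_le _ hm
  have h3 : ‖((chartMap L)^[n] p).1‖ ≤ ‖p.1‖ :=
    (h.norm_iterate_fst_le hD hE hp n).trans
      (mul_le_of_le_one_right (norm_nonneg _) (pow_le_one₀ (by norm_num) (by norm_num)))
  -- Here `9 / 4` is `δ + 8 δ` at `δ = 1 / 4`; times the `3 / 2` from the logarithm it stays below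
  -- `4`.
  have h4 : ‖((chartMap L)^[n] p).1‖ + ‖((chartMap L)^[n] p).2‖ ≤ 9 / 4 := by
    linarith [hm.1, hm.2, h.le]
  have h5 : C * (‖((chartMap L)^[n] p).1‖ *
      (‖((chartMap L)^[n] p).1‖ + ‖((chartMap L)^[n] p).2‖)) ≤ C * (‖p.1‖ * (9 / 4)) := by
    have := h.const_pos
    gcongr
  have h6 : 0 ≤ C * ‖p.1‖ := mul_nonneg h.const_pos.le (norm_nonneg _)
  nlinarith

theorem hasSum_half (K : ℝ) : HasSum (fun n : ℕ => K * (1 / 2 : ℝ) ^ (n + 1)) K := by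
  have := (hasSum_geometric_two' K)
  convert this using 2 with n
  rw [pow_succ, one_div_pow]
  ring

theorem hasSum_logSum (h : IsAttracting L C δ) (hD : 2 ≤ deg L) (hE : deg L.tail < deg L)
    {p : ℂ × ℂ} (hp : p ∈ polydisc δ) :
    HasSum (fun n : ℕ => Complex.log (V L ((chartMap L)^[n] p)) * (-1 / (deg L : ℂ) ^ (n + 1)))
      (logSum L p) :=
  (Summable.of_norm_bounded (hasSum_half _).summable (h.norm_term_le hD hE hp)).hasSum

theorem norm_logSum_le_linear (h : IsAttracting L C δ) (hD : 2 ≤ deg L) (hE : deg L.tail < deg L)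
    {p : ℂ × ℂ} (hp : p ∈ polydisc δ) : ‖logSum L p‖ ≤ 4 * C * ‖p.1‖ :=
  tsum_of_norm_bounded (hasSum_half _) (h.norm_term_le hD hE hp)

theorem differentiableOn_iterate (h : IsAttracting L C δ) (hD : 2 ≤ deg L)
    (hE : deg L.tail < deg L) (n : ℕ) :
    DifferentiableOn ℂ ((chartMap L)^[n]) (polydisc δ) :=
  h.differentiableOn_chartMap.iterate (fun _ hp => h.chartMap_mem hD hE hp) n

theorem differentiableOn_logSum (h : IsAttracting L C δ) (hD : 2 ≤ deg L)
    (hE : deg L.tail < deg L) : DifferentiableOn ℂ (logSum L) (polydisc δ) := by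
  have hC := h.const_pos
  refine differentiableOn_tsum_of_norm_le (M := fun n => (4 * C * δ) * (1 / 2 : ℝ) ^ (n + 1))
    (isOpen_polydisc δ) (hasSum_half _).summable (fun n => ?_) fun n p hp => ?_
  · refine DifferentiableOn.mul_const (DifferentiableOn.clog ?_ fun p hp => ?_) _
    · exact (differentiable_V L).comp_differentiableOn (h.differentiableOn_iterate hD hE n)
    · have := Complex.mem_slitPlane_of_norm_lt_one
        ((h.V_sub_le_half _ (h.iterate_mem hD hE hp n)).trans_lt (by norm_num))
      simpa using this
  · refine (h.norm_term_le hD hE hp n).trans ?_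
    gcongr
    exact hp.1.le

theorem bottcherCoord_eq (h : IsAttracting L C δ) (hD : 2 ≤ deg L) (hE : deg L.tail < deg L)
    {p : ℂ × ℂ} (hp : p ∈ polydisc δ) :
    bottcherCoord L p = p.1 * Complex.exp (logSum L p) := by
  rw [bottcherCoord, ← (h.hasSum_logSum hD hE hp).cexp.tprod_eq]
  congr 2 with n
  simp [Complex.cpow_def_of_ne_zero (h.V_ne_zero (h.iterate_mem hD hE hp n))]

/-- Splitting off the term of index `0` and shifting the series. Working with logarithms avoids any
choice of roots; exponentiated, this is the Böttcher equation `x ∘ F = x ^ D`. -/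
theorem logSum_chartMap (h : IsAttracting L C δ) (hD : 2 ≤ deg L) (hE : deg L.tail < deg L)
    {p : ℂ × ℂ} (hp : p ∈ polydisc δ) :
    logSum L (chartMap L p) = deg L * logSum L p + Complex.log (V L p) := by
  have hD0 : (deg L : ℂ) ≠ 0 := by
    have : deg L ≠ 0 := by omega
    exact_mod_cast this
  have h1 := ((hasSum_nat_add_iff' 1).2 (h.hasSum_logSum hD hE hp)).mul_left (deg L : ℂ)
  have h2 := h.hasSum_logSum hD hE (h.chartMap_mem hD hE hp)
  have h3 : (fun n : ℕ => (deg L : ℂ) * (Complex.log (V L ((chartMap L)^[n + 1] p))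
      * (-1 / (deg L : ℂ) ^ (n + 1 + 1)))) = fun n : ℕ =>
      Complex.log (V L ((chartMap L)^[n] (chartMap L p))) * (-1 / (deg L : ℂ) ^ (n + 1)) := by
    funext n
    rw [← Function.iterate_succ_apply, pow_succ _ (n + 1)]
    field_simp
  rw [h3] at h1
  rw [h2.unique h1]
  simp only [Finset.sum_range_one, Function.iterate_zero, id]
  field_simp
  ring

theorem exp_logSum_chartMap (h : IsAttracting L C δ) (hD : 2 ≤ deg L) (hE : deg L.tail < deg L)
    {p : ℂ × ℂ} (hp : p ∈ polydisc δ) :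
    Complex.exp (logSum L (chartMap L p)) = Complex.exp (logSum L p) ^ deg L * V L p := by
  rw [h.logSum_chartMap hD hE hp, Complex.exp_add, Complex.exp_log (h.V_ne_zero hp),
    Complex.exp_nat_mul]

theorem bottcherCoord_chartMap (h : IsAttracting L C δ) (hD : 2 ≤ deg L)
    (hE : deg L.tail < deg L) {p : ℂ × ℂ} (hp : p ∈ polydisc δ) :
    bottcherCoord L (chartMap L p) = bottcherCoord L p ^ deg L := by
  have := h.V_ne_zero hp
  rw [h.bottcherCoord_eq hD hE (h.chartMap_mem hD hE hp), h.bottcherCoord_eq hD hE hp,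
    h.exp_logSum_chartMap hD hE hp, mul_pow, chartMap]
  field_simp

/-- The functional equation improves the linear bound: `D S = S ∘ F - log V`, where `S ∘ F` is
bounded linearly by the first component of the image, which is `O(t ^ D)` with `D ≥ 2`, and `log V`
already has the required order. -/
theorem norm_logSum_le (h : IsAttracting L C δ) (hD : 2 ≤ deg L) (hE : deg L.tail < deg L)
    {p : ℂ × ℂ} (hp : p ∈ polydisc δ) :
    ‖logSum L p‖ ≤ 10 * C * (‖p.1‖ * (‖p.1‖ + ‖p.2‖)) := by
  have h1 := h.norm_logSum_le_linear hD hE (h.chartMap_mem hD hE hp)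
  have h2 := h.fst_le p hp
  have h3 := h.norm_log_V_le hp
  have h4 := h.V_sub_le p hp
  have hC := h.const_pos
  have h5 : ‖p.1‖ ^ deg L ≤ ‖p.1‖ * (‖p.1‖ + ‖p.2‖) := by
    calc ‖p.1‖ ^ deg L ≤ ‖p.1‖ ^ 2 :=
          pow_le_pow_of_le_one (norm_nonneg _) (by linarith [hp.1, h.le]) hD
      _ ≤ _ := by nlinarith [mul_nonneg (norm_nonneg p.1) (norm_nonneg p.2)]
  have h6 : ‖(deg L : ℂ) * logSum L p‖ ≤ 4 * C * (2 * (‖p.1‖ * (‖p.1‖ + ‖p.2‖)))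
      + 3 / 2 * (C * (‖p.1‖ * (‖p.1‖ + ‖p.2‖))) := by
    rw [eq_sub_of_add_eq (h.logSum_chartMap hD hE hp).symm]
    refine (norm_sub_le _ _).trans (add_le_add (h1.trans ?_) (h3.trans ?_))
    · gcongr
      exact h2.trans (by linarith)
    · gcongr
  rw [norm_mul, Complex.norm_natCast] at h6
  have h7 : (2 : ℝ) ≤ deg L := by exact_mod_cast hD
  have h8 : 0 ≤ C * (‖p.1‖ * (‖p.1‖ + ‖p.2‖)) := by positivity
  nlinarith [norm_nonneg (logSum L p)]

end IsAttracting

end Henon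

/-! ### Inverting the Böttcher coordinate, and the Jacobian of the germ at infinity. -/

theorem contDiffOn_one_of_differentiableOn {f : ℂ × ℂ → ℂ} {U : Set (ℂ × ℂ)} (hU : IsOpen U)
    (hf : DifferentiableOn ℂ f U) : ContDiffOn ℂ 1 f U := by
  rw [← zero_add (1 : WithTop ℕ∞), contDiffOn_succ_iff_fderiv_of_isOpen hU]
  refine ⟨hf, by simp, contDiffOn_zero.2 (continuousOn_clm_apply.2 fun v => ?_)⟩
  exact (differentiableOn_fderiv_apply hU hf v).continuousOn

namespace Henon

open Filter

theorem HolomorphicGerm.of_differentiableOn {E : Type*} [NormedAddCommGroup E] [NormedSpace ℂ E]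
    {f : ℂ × ℂ → E} {δ : ℝ} (hδ : 0 < δ) (hf : DifferentiableOn ℂ f (polydisc δ)) :
    HolomorphicGerm f := by
  filter_upwards [polydisc_mem_nhds hδ] with p hp
  exact hf.differentiableAt ((isOpen_polydisc δ).mem_nhds hp)

theorem HolomorphicGerm.exists_differentiableOn {E : Type*} [NormedAddCommGroup E]
    [NormedSpace ℂ E] {f : ℂ × ℂ → E} (hf : HolomorphicGerm f) :
    ∃ δ > 0, DifferentiableOn ℂ f (polydisc δ) := by
  obtain ⟨δ, hδ, h⟩ := exists_polydisc_of_eventually hf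
  exact ⟨δ, hδ, fun p hp => (h p hp).differentiableWithinAt⟩

namespace IsAttracting

variable {L : List HenonFactor} {C δ : ℝ}

theorem differentiableOn_bottcherCoord (h : IsAttracting L C δ) (hD : 2 ≤ deg L)
    (hE : deg L.tail < deg L) : DifferentiableOn ℂ (bottcherCoord L) (polydisc δ) := by
  have h1 := h.differentiableOn_logSum hD hE
  refine DifferentiableOn.congr (f := fun p => p.1 * Complex.exp (logSum L p)) ?_
    fun p hp => h.bottcherCoord_eq hD hE hp
  exact differentiableOn_fst.mul h1.cexp

theorem zero_mem (h : IsAttracting L C δ) : (0 : ℂ × ℂ) ∈ polydisc δ :=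
  mem_of_mem_nhds (polydisc_mem_nhds h.pos)

theorem logSum_eq_zero (h : IsAttracting L C δ) (hD : 2 ≤ deg L)
    (hE : deg L.tail < deg L) {p : ℂ × ℂ} (hp : p ∈ polydisc δ) (hp1 : p.1 = 0) :
    logSum L p = 0 := by
  have := h.norm_logSum_le_linear hD hE hp
  rw [hp1] at this
  simpa using this

theorem hasFDerivAt_bottcherCoord (h : IsAttracting L C δ) (hD : 2 ≤ deg L)
    (hE : deg L.tail < deg L) {p : ℂ × ℂ} (hp : p ∈ polydisc δ) :
    HasFDerivAt (bottcherCoord L)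
      (p.1 • (Complex.exp (logSum L p) • fderiv ℂ (logSum L) p)
        + Complex.exp (logSum L p) • ContinuousLinearMap.fst ℂ ℂ ℂ) p := by
  have hU := (isOpen_polydisc δ).mem_nhds hp
  have h1 := ((h.differentiableOn_logSum hD hE).differentiableAt hU).hasFDerivAt
  refine HasFDerivAt.congr_of_eventuallyEq (hasFDerivAt_fst.mul h1.cexp) ?_
  filter_upwards [hU] with q hq using h.bottcherCoord_eq hD hE hq

theorem bottcher_zero (h : IsAttracting L C δ) (hD : 2 ≤ deg L)
    (hE : deg L.tail < deg L) : bottcher L 0 = 0 := by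
  rw [bottcher, h.bottcherCoord_eq hD hE h.zero_mem]
  simp

/-- The Böttcher coordinate is invertible near the origin. -/
theorem exists_inverse (h : IsAttracting L C δ) (hD : 2 ≤ deg L) (hE : deg L.tail < deg L) :
    ∃ τ : ℂ × ℂ → ℂ, HolomorphicGerm τ ∧ τ 0 = 0 ∧
      (∀ᶠ q in 𝓝 0, bottcher L (τ q, q.2) = q) ∧ ∀ᶠ p in 𝓝 0, τ (bottcher L p) = p.1 := by
  have hc : ContDiffAt ℂ 1 (bottcher L) 0 :=
    ((contDiffOn_one_of_differentiableOn (isOpen_polydisc δ)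
      (h.differentiableOn_bottcherCoord hD hE)).contDiffAt
        (polydisc_mem_nhds h.pos)).prodMk contDiffAt_snd
  have hd : HasFDerivAt (bottcher L)
      ((ContinuousLinearEquiv.refl ℂ (ℂ × ℂ) : (ℂ × ℂ) ≃L[ℂ] (ℂ × ℂ)) : (ℂ × ℂ) →L[ℂ] (ℂ × ℂ)) 0 := by
    -- The derivative at the origin is the identity because `logSum` vanishes on `t = 0`.
    refine ((h.hasFDerivAt_bottcherCoord hD hE h.zero_mem).prodMk hasFDerivAt_snd).congr_fderiv ?_
    ext <;> simp [h.logSum_eq_zero hD hE h.zero_mem rfl]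
  have hs := hc.hasStrictFDerivAt' hd one_ne_zero
  have h0 := h.bottcher_zero hD hE
  have hinv : ContDiffAt ℂ 1 (hs.localInverse (bottcher L) _ 0) 0 := by
    have := hc.to_localInverse hd one_ne_zero
    rwa [h0] at this
  have hr := hs.eventually_right_inverse
  rw [h0] at hr
  have hsnd : ∀ᶠ q in 𝓝 (0 : ℂ × ℂ), (hs.localInverse (bottcher L) _ 0 q).2 = q.2 := by
    filter_upwards [hr] with q hq
    have := congrArg Prod.snd hq
    exact this
  refine ⟨fun q => (hs.localInverse (bottcher L) _ 0 q).1, ?_, ?_, ?_, ?_⟩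
  · filter_upwards [hinv.eventually (by simp)] with q hq
    exact (hq.differentiableAt one_ne_zero).fst
  · have := hs.localInverse_apply_image
    rw [h0] at this
    simp [this]
  · filter_upwards [hr, hsnd] with q hq hq2
    rwa [← hq2]
  · filter_upwards [hs.eventually_left_inverse] with p hp
    rw [hp]

end IsAttracting

open MvPolynomial in
theorem hasDerivAt_ev (q : MvPolynomial (Fin 2) ℂ) {z w : ℂ → ℂ} {z' w' x : ℂ}
    (hz : HasDerivAt z z' x) (hw : HasDerivAt w w' x) :
    HasDerivAt (fun s => ev (z s, w s) q)
      (ev (z x, w x) (pderiv 0 q) * z' + ev (z x, w x) (pderiv 1 q) * w') x := by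
  induction q using MvPolynomial.induction_on with
  | C a => simpa [ev] using hasDerivAt_const x a
  | add p q hp hq =>
    refine ((hp.add hq).congr_deriv ?_).congr_of_eventuallyEq (.of_forall fun s => ?_)
    · simp only [ev, map_add]
      ring
    · simp [ev]
  | mul_X p i hp =>
    have hX : HasDerivAt (fun s => ev (z s, w s) (X i))
        (ev (z x, w x) (pderiv 0 (X i)) * z' + ev (z x, w x) (pderiv 1 (X i)) * w') x := by
      fin_cases i
      · simpa [ev, pderiv_X] using hz
      · simpa [ev, pderiv_X] using hw
    refine ((hp.mul hX).congr_deriv ?_).congr_of_eventuallyEq (.of_forall fun s => ?_)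
    · simp only [ev, Derivation.leibniz, map_add, map_mul, smul_eq_mul]
      ring
    · simp [ev]

theorem chartMap_eq {L : List HenonFactor} (h : AllReduced L) (hE : deg L.tail ≤ deg L)
    {p : ℂ × ℂ} (hp : p.1 ≠ 0) :
    chartMap L p = (1 / ev (1 / p.1, p.2 / p.1) (Q L),
      ev (1 / p.1, p.2 / p.1) (Q L.tail) / ev (1 / p.1, p.2 / p.1) (Q L)) := by
  have h1 : p.1 ^ deg L ≠ 0 := pow_ne_zero _ hp
  rw [chartMap, V_eq h hp, V_eq h.tail' hp, ← mul_assoc, ← pow_add, Nat.sub_add_cancel hE,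
    mul_div_mul_left _ _ h1, div_mul_cancel_left₀ h1, inv_eq_one_div]

/-- The Jacobian determinant of the germ at infinity, evaluated on two tangent vectors. -/
theorem chartMap_jacobian {L : List HenonFactor} (hL : L ≠ []) (h : AllReduced L)
    (hE : deg L.tail ≤ deg L) {p : ℂ × ℂ} (hp : p.1 ≠ 0) (hV : V L p ≠ 0) (v : ℂ) :
    (fderiv ℂ (chartMap L) p (1, 0)).1 * (fderiv ℂ (chartMap L) p (v, 1)).2
      - (fderiv ℂ (chartMap L) p (v, 1)).1 * (fderiv ℂ (chartMap L) p (1, 0)).2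
      = jac L * (chartMap L p).1 ^ 3 / p.1 ^ 3 := by
  have hev : ev (1 / p.1, p.2 / p.1) (Q L) ≠ 0 := by
    intro h0
    rw [V_eq h hp, h0, mul_zero] at hV
    exact hV rfl
  have hd : DifferentiableAt ℂ (chartMap L) p := by
    have h1 := (differentiable_V L).differentiableAt (x := p)
    have h2 := (differentiable_V L.tail).differentiableAt (x := p)
    have h3 := h1.fun_inv hV
    unfold chartMap
    simp only [div_eq_mul_inv]
    fun_prop
  set q0 := MvPolynomial.pderiv 0 (Q L)
  set q1 := MvPolynomial.pderiv 1 (Q L)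
  set r0 := MvPolynomial.pderiv 0 (Q L.tail)
  set r1 := MvPolynomial.pderiv 1 (Q L.tail)
  set e := (1 / p.1, p.2 / p.1) with he
  have key : ∀ u : ℂ × ℂ, (fderiv ℂ (chartMap L) p u) =
      (-(ev e q0 * (-u.1 / p.1 ^ 2) + ev e q1 * ((u.2 * p.1 - p.2 * u.1) / p.1 ^ 2))
        / ev e (Q L) ^ 2,
      ((ev e r0 * (-u.1 / p.1 ^ 2) + ev e r1 * ((u.2 * p.1 - p.2 * u.1) / p.1 ^ 2)) * ev e (Q L)
        - ev e (Q L.tail) *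
          (ev e q0 * (-u.1 / p.1 ^ 2) + ev e q1 * ((u.2 * p.1 - p.2 * u.1) / p.1 ^ 2)))
        / ev e (Q L) ^ 2) := by
    intro u
    have hl : HasDerivAt (fun s : ℂ => p + s • u) u 0 := by
      simpa using ((hasDerivAt_id (0 : ℂ)).smul_const u).const_add p
    have hl1 : HasDerivAt (fun s : ℂ => p.1 + s * u.1) u.1 0 := by
      simpa using ((hasDerivAt_id (0 : ℂ)).mul_const u.1).const_add p.1
    have hl2 : HasDerivAt (fun s : ℂ => p.2 + s * u.2) u.2 0 := by
      simpa using ((hasDerivAt_id (0 : ℂ)).mul_const u.2).const_add p.2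
    have hne : p.1 + 0 * u.1 ≠ 0 := by simpa using hp
    have hz : HasDerivAt (fun s : ℂ => 1 / (p.1 + s * u.1)) (-u.1 / p.1 ^ 2) 0 := by
      simpa using hl1.fun_inv hne
    have hw : HasDerivAt (fun s : ℂ => (p.2 + s * u.2) / (p.1 + s * u.1))
        ((u.2 * p.1 - p.2 * u.1) / p.1 ^ 2) 0 := by
      simpa using hl2.fun_div hl1 hne
    have hq := hasDerivAt_ev (Q L) hz hw
    have hr := hasDerivAt_ev (Q L.tail) hz hw
    simp only [zero_mul, add_zero] at hq hr
    rw [← he] at hq hr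
    have hnear : ∀ᶠ s : ℂ in 𝓝 0, p.1 + s * u.1 ≠ 0 :=
      hl1.continuousAt.eventually_ne hne
    have hev0 : ev (1 / (p.1 + 0 * u.1), (p.2 + 0 * u.2) / (p.1 + 0 * u.1)) (Q L) ≠ 0 := by
      simpa [he] using hev
    have h1 := hq.fun_inv hev0
    have h2 := hr.fun_div hq hev0
    have h3 : HasDerivAt (fun s : ℂ => chartMap L (p + s • u)) (fderiv ℂ (chartMap L) p u) 0 := by
      have h4 : HasFDerivAt (chartMap L) (fderiv ℂ (chartMap L) p) (p + (0 : ℂ) • u) := by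
        simpa using hd.hasFDerivAt
      exact h4.comp_hasDerivAt (0 : ℂ) hl
    refine h3.unique (((h1.prodMk h2).congr_deriv ?_).congr_of_eventuallyEq ?_)
    · simp [he, q0, q1, r0, r1]
    · filter_upwards [hnear] with s hs
      rw [chartMap_eq h hE (by simpa using hs)]
      simp
  have hjac : ev e q0 * ev e r1 - ev e q1 * ev e r0 = jac L := by
    have := congrArg (ev e) (jacobian_Q hL)
    simpa [ev] using this
  -- The two cubes come from `dz ∧ dw' = -t ^ (-3) dt ∧ dw`, at the point and at its image.
  rw [key, key, chartMap_eq h hE hp, ← hjac, ← he]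
  simp only
  field_simp
  ring

end Henon

/-! ### The invariant density behind the second step. -/

/-- The primitive vanishing at `0`, written as `w` times an average over `[0, w]`: this exhibits the
factor `w` that the shape of `Ψ` demands. -/
theorem hasDerivAt_mul_integral_segment {f : ℂ → ℂ} {r : ℝ} (hf : DifferentiableOn ℂ f (Metric.ball 0 r))
    {w : ℂ} (hw : w ∈ Metric.ball 0 r) :
    HasDerivAt (fun w => w * ∫ s in (0 : ℝ)..1, f (s * w)) (f w) w := by
  obtain ⟨g, hg⟩ := hf.isExactOn_ball
  have hseg : ∀ z ∈ Metric.ball (0 : ℂ) r, ∀ s ∈ Set.uIcc (0 : ℝ) 1,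
      (s : ℂ) * z ∈ Metric.ball (0 : ℂ) r := by
    intro z hz s hs
    rw [Set.uIcc_of_le zero_le_one] at hs
    rw [mem_ball_zero_iff] at hz ⊢
    rw [norm_mul, Complex.norm_real, Real.norm_of_nonneg hs.1]
    exact (mul_le_of_le_one_left (norm_nonneg _) hs.2).trans_lt hz
  have key : ∀ z ∈ Metric.ball (0 : ℂ) r, z * ∫ s in (0 : ℝ)..1, f (s * z) = g z - g 0 := by
    intro z hz
    have h1 : ∀ s ∈ Set.uIcc (0 : ℝ) 1, HasDerivAt (fun s : ℝ => g (s * z)) (z * f (s * z)) s := by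
      intro s hs
      have h2 : HasDerivAt (fun s : ℝ => (s : ℂ) * z) z s := by
        simpa using (Complex.ofRealCLM.hasDerivAt (x := s)).mul_const z
      have h3 := (hg _ (hseg z hz s hs)).comp s h2
      rwa [mul_comm] at h3
    have h4 : ContinuousOn (fun s : ℝ => z * f (s * z)) (Set.uIcc 0 1) :=
      continuousOn_const.mul (hf.continuousOn.comp (by fun_prop) (hseg z hz))
    rw [← intervalIntegral.integral_const_mul,
      intervalIntegral.integral_eq_sub_of_hasDerivAt h1 h4.intervalIntegrable]
    simp
  refine ((hg w hw).sub_const (g 0)).congr_of_eventuallyEq ?_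
  filter_upwards [Metric.isOpen_ball.mem_nhds hw] with z hz using key z hz

namespace Henon

open Filter

/-- The density with respect to `dw` of the change of coordinates in the second step, as a function
of the affine coordinates `(t, w)` at infinity. -/
noncomputable def density (L : List HenonFactor) (p : ℂ × ℂ) : ℂ :=
  Complex.exp (2 * logSum L p) / (1 + p.1 * fderiv ℂ (logSum L) p (1, 0))

namespace IsAttracting

variable {L : List HenonFactor} {C δ : ℝ}

/-- Cauchy's estimate on the disc of radius `‖t‖ + ‖w‖` around `t`, on whose boundary
`norm_logSum_le` bounds `logSum` by a multiple of the square of that radius. -/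
theorem norm_mul_fderiv_logSum_le (h : IsAttracting L C δ) (hD : 2 ≤ deg L)
    (hE : deg L.tail < deg L) {p : ℂ × ℂ} (hp : p ∈ polydisc (δ / 10)) :
    ‖p.1 * fderiv ℂ (logSum L) p (1, 0)‖ ≤ 60 * C * (‖p.1‖ * (‖p.1‖ + ‖p.2‖)) := by
  rcases eq_or_ne p.1 0 with h0 | h0
  · simp [h0]
  have ht : 0 < ‖p.1‖ := norm_pos_iff.2 h0
  have hC := h.const_pos
  set r := ‖p.1‖ + ‖p.2‖ with hr
  have hr0 : 0 < r := by positivity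
  -- In the polydisc of radius `δ / 10` one has `r < 9 δ / 10` and `‖t‖ < δ / 10`, so the disc stays
  -- inside radius `δ`.
  have hmem : ∀ z ∈ Metric.closedBall p.1 r, ((z, p.2) : ℂ × ℂ) ∈ polydisc δ ∧ ‖z‖ ≤ 2 * r := by
    intro z hz
    rw [mem_closedBall_iff_norm] at hz
    have h1 : ‖z‖ ≤ ‖z - p.1‖ + ‖p.1‖ := by simpa using norm_add_le (z - p.1) p.1
    have h2 := hp.1
    have h3 := hp.2
    have h4 := norm_nonneg p.2
    exact ⟨⟨by linarith, by linarith [h.pos]⟩, by linarith⟩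
  have hd : ∀ z ∈ Metric.closedBall p.1 r, HasDerivAt (fun z => logSum L (z, p.2))
      (fderiv ℂ (logSum L) (z, p.2) (1, 0)) z := by
    intro z hz
    have h1 := ((h.differentiableOn_logSum hD hE).differentiableAt
      ((isOpen_polydisc δ).mem_nhds (hmem z hz).1)).hasFDerivAt
    exact h1.comp_hasDerivAt z ((hasDerivAt_id z).prodMk (hasDerivAt_const z p.2))
  have h1 : ‖deriv (fun z => logSum L (z, p.2)) p.1‖ ≤ 60 * C * r ^ 2 / r := by
    refine Complex.norm_deriv_le_of_forall_mem_sphere_norm_le hr0 ?_ ?_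
    · refine DifferentiableOn.diffContOnCl fun z hz => ?_
      rw [closure_ball _ hr0.ne'] at hz
      exact (hd z hz).differentiableAt.differentiableWithinAt
    · intro z hz
      obtain ⟨h2, h3⟩ := hmem z (Metric.sphere_subset_closedBall hz)
      refine (h.norm_logSum_le hD hE h2).trans ?_
      have h4 : ‖z‖ * (‖z‖ + ‖p.2‖) ≤ (2 * r) * (2 * r + r) := by
        gcongr
        linarith
      calc 10 * C * (‖z‖ * (‖z‖ + ‖p.2‖)) ≤ 10 * C * ((2 * r) * (2 * r + r)) := by gcongr
        _ = 60 * C * r ^ 2 := by ring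
  rw [(hd p.1 (Metric.mem_closedBall_self hr0.le)).deriv] at h1
  rw [norm_mul]
  calc ‖p.1‖ * ‖fderiv ℂ (logSum L) p (1, 0)‖ ≤ ‖p.1‖ * (60 * C * r ^ 2 / r) := by gcongr
    _ = _ := by field_simp

/-- The estimates on which the second step rests. -/
theorem exists_density_estimates (h : IsAttracting L C δ) (hD : 2 ≤ deg L)
    (hE : deg L.tail < deg L) : ∃ ε > 0, ε ≤ δ ∧ ∃ K > 0, ∀ p ∈ polydisc ε,
      1 + p.1 * fderiv ℂ (logSum L) p (1, 0) ≠ 0 ∧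
      ‖density L p - 1‖ ≤ K * (‖p.1‖ * (‖p.1‖ + ‖p.2‖)) ∧
      ‖Complex.exp (logSum L p) - 1‖ ≤ 1 / 2 ∧
      ‖Complex.exp (logSum L p) - 1‖ ≤ K * (‖p.1‖ * (‖p.1‖ + ‖p.2‖)) := by
  have hC := h.const_pos
  have hδ := h.pos
  -- The second bound yields `120 C m ≤ 1`, hence `‖t ∂S/∂t‖ ≤ 60 C m ≤ 1 / 2`. Then `density - 1`
  -- has numerator at most `(40 + 60) C m` and denominator at least `1 / 2`, which gives `200 C`.
  refine ⟨min (δ / 10) (1 / (1080 * C)), by positivity,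
    (min_le_left _ _).trans (by linarith), 200 * C, by positivity, fun p hp => ?_⟩
  have hp' := polydisc_mono (min_le_left _ _) hp
  have hpδ : p ∈ polydisc δ := polydisc_mono (by linarith) hp'
  have h1 := h.norm_mul_fderiv_logSum_le hD hE hp'
  have h2 := h.norm_logSum_le hD hE hpδ
  set m := ‖p.1‖ * (‖p.1‖ + ‖p.2‖) with hm
  have hm0 : 0 ≤ m := by positivity
  have hCm : 120 * C * m ≤ 1 := by
    have h3 : ‖p.1‖ * (1080 * C) < 1 := by
      rw [← lt_div_iff₀ (by positivity)]
      exact hp.1.trans_le (min_le_right _ _)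
    have h4 : ‖p.1‖ + ‖p.2‖ ≤ 9 / 4 := by linarith [hpδ.1, hpδ.2, h.le]
    have h5 : m ≤ ‖p.1‖ * (9 / 4) := mul_le_mul_of_nonneg_left h4 (norm_nonneg _)
    have h6 : C * m ≤ C * (‖p.1‖ * (9 / 4)) := by gcongr
    linarith
  set z := p.1 * fderiv ℂ (logSum L) p (1, 0) with hz
  have hz1 : ‖z‖ ≤ 1 / 2 := by linarith
  have hz2 : 1 / 2 ≤ ‖1 + z‖ := by
    have := norm_sub_le (1 + z) z
    rw [add_sub_cancel_right, norm_one] at this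
    linarith
  have hne : 1 + z ≠ 0 := norm_pos_iff.1 (by linarith)
  have e1 : ‖Complex.exp (logSum L p) - 1‖ ≤ 2 * ‖logSum L p‖ :=
    Complex.norm_exp_sub_one_le (by linarith)
  have e2 : ‖Complex.exp (2 * logSum L p) - 1‖ ≤ 2 * ‖2 * logSum L p‖ :=
    Complex.norm_exp_sub_one_le (by rw [norm_mul, Complex.norm_two]; linarith)
  rw [norm_mul, Complex.norm_two] at e2
  refine ⟨hne, ?_, by linarith, by nlinarith⟩
  have e3 : density L p - 1 = (Complex.exp (2 * logSum L p) - 1 - z) / (1 + z) := by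
    rw [density, ← hz]
    field_simp
    ring
  rw [e3, norm_div, div_le_iff₀ (by linarith)]
  calc ‖Complex.exp (2 * logSum L p) - 1 - z‖ ≤ 40 * C * m + 60 * C * m :=
        (norm_sub_le _ _).trans (add_le_add (by linarith) h1)
    _ ≤ 200 * C * m * ‖1 + z‖ := by
      have : 0 ≤ C * m := by positivity
      nlinarith

theorem differentiableOn_density (h : IsAttracting L C δ) (hD : 2 ≤ deg L)
    (hE : deg L.tail < deg L) {ε : ℝ} (hε : ε ≤ δ)
    (hne : ∀ p ∈ polydisc ε, 1 + p.1 * fderiv ℂ (logSum L) p (1, 0) ≠ 0) :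
    DifferentiableOn ℂ (density L) (polydisc ε) := by
  have h1 := (h.differentiableOn_logSum hD hE)
  have h2 := (differentiableOn_fderiv_apply (isOpen_polydisc δ) h1 (1, 0)).mono (polydisc_mono hε)
  have h3 := ((h1.mono (polydisc_mono hε)).const_mul 2).cexp
  have h4 : DifferentiableOn ℂ (fun p : ℂ × ℂ => 1 + p.1 * fderiv ℂ (logSum L) p (1, 0))
      (polydisc ε) := (differentiableOn_fst.mul h2).const_add 1
  have h5 := h4.fun_inv hne
  have h6 := h3.mul h5
  refine h6.congr fun p _ => ?_
  simp [density, div_eq_mul_inv]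

/-- How the second coordinate of the germ changes along the level curves of the Böttcher
coordinate. -/
theorem fderiv_chartMap_mul_density (h : IsAttracting L C δ) (hL : L ≠ []) (hR : AllReduced L)
    (hD : 2 ≤ deg L) (hE : deg L.tail < deg L) {p : ℂ × ℂ} (hp : p ∈ polydisc δ) (hp1 : p.1 ≠ 0)
    (hne : 1 + p.1 * fderiv ℂ (logSum L) p (1, 0) ≠ 0)
    (hne' : 1 + (chartMap L p).1 * fderiv ℂ (logSum L) (chartMap L p) (1, 0) ≠ 0) {v : ℂ}
    (hv : fderiv ℂ (bottcherCoord L) p (v, 1) = 0) :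
    (fderiv ℂ (chartMap L) p (v, 1)).2 * density L (chartMap L p)
      = jac L / deg L * bottcherCoord L p ^ (2 * deg L - 2) * density L p := by
  have hU := (isOpen_polydisc δ).mem_nhds hp
  have hp' := h.chartMap_mem hD hE hp
  have hcm := (h.differentiableOn_chartMap.differentiableAt hU).hasFDerivAt
  have hb := h.hasFDerivAt_bottcherCoord hD hE hp
  have hb' := h.hasFDerivAt_bottcherCoord hD hE hp'
  -- Differentiate the Böttcher equation in two ways.
  have hcomp : HasFDerivAt (fun q => bottcherCoord L q ^ deg L) _ p :=
    (hb'.comp p hcm).congr_of_eventuallyEq (by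
      filter_upwards [hU] with q hq using (h.bottcherCoord_chartMap hD hE hq).symm)
  have hrel := hcomp.unique (hb.pow (deg L))
  have hjac := chartMap_jacobian hL hR hE.le hp1 (h.V_ne_zero hp) v
  have hxD := h.bottcherCoord_chartMap hD hE hp
  rw [h.bottcherCoord_eq hD hE hp', h.bottcherCoord_eq hD hE hp] at hxD
  set b' := fderiv ℂ (bottcherCoord L) (chartMap L p) with hb'_def
  have hb1 : fderiv ℂ (bottcherCoord L) p (1, 0)
      = Complex.exp (logSum L p) * (1 + p.1 * fderiv ℂ (logSum L) p (1, 0)) := by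
    rw [hb.fderiv]
    simp
    ring
  have hb1' : b' (1, 0) = Complex.exp (logSum L (chartMap L p))
      * (1 + (chartMap L p).1 * fderiv ℂ (logSum L) (chartMap L p) (1, 0)) := by
    rw [hb'_def, hb'.fderiv]
    simp
    ring
  rw [← hb'.fderiv, ← hb.fderiv, ← hb'_def] at hrel
  set c := fderiv ℂ (chartMap L) p
  have hsplit : ∀ u : ℂ × ℂ, b' u = u.1 * b' (1, 0) + u.2 * b' (0, 1) := by
    intro u
    have : u = u.1 • (1, 0) + u.2 • (0, 1) := by ext <;> simp
    conv_lhs => rw [this]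
    rw [map_add, map_smul, map_smul, smul_eq_mul, smul_eq_mul]
  have hr1 : (c (v, 1)).1 * b' (1, 0) + (c (v, 1)).2 * b' (0, 1) = 0 := by
    rw [← hsplit]
    have := congrArg (fun l : (ℂ × ℂ) →L[ℂ] ℂ => l (v, 1)) hrel
    simpa [hv] using this
  have hr2 : (c (1, 0)).1 * b' (1, 0) + (c (1, 0)).2 * b' (0, 1)
      = deg L * bottcherCoord L p ^ (deg L - 1) * fderiv ℂ (bottcherCoord L) p (1, 0) := by
    rw [← hsplit]
    have := congrArg (fun l : (ℂ × ℂ) →L[ℂ] ℂ => l (1, 0)) hrel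
    simpa using this
  -- The image of the level direction `(v, 1)` is again a level direction (`hr1`). Eliminating `b'
  -- (0, 1)` with the relation for `(1, 0)` produces the Jacobian determinant.
  have hmain : b' (1, 0) * (jac L * (chartMap L p).1 ^ 3 / p.1 ^ 3)
      = deg L * bottcherCoord L p ^ (deg L - 1) * fderiv ℂ (bottcherCoord L) p (1, 0)
        * (c (v, 1)).2 := by
    rw [← hjac, ← hr2]
    linear_combination (-(c (1, 0)).2) * hr1
  rw [hb1, hb1', h.bottcherCoord_eq hD hE hp] at hmain
  rw [h.bottcherCoord_eq hD hE hp, density, density]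
  obtain ⟨d, hd⟩ := Nat.exists_eq_add_of_le hD
  have hd0 : (deg L : ℂ) ≠ 0 := by
    have : deg L ≠ 0 := by omega
    exact_mod_cast this
  rw [show 2 * deg L - 2 = 2 * d + 2 by omega]
  rw [show deg L - 1 = d + 1 by omega] at hmain
  rw [hd] at hxD
  have e2 : ∀ z, Complex.exp (2 * z) = Complex.exp z ^ 2 := fun z => by
    rw [← Complex.exp_nat_mul]
    norm_num
  rw [e2, e2]
  set e := Complex.exp (logSum L p) with he
  set e' := Complex.exp (logSum L (chartMap L p)) with he'
  have he0 : e ≠ 0 := Complex.exp_ne_zero _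
  set B := 1 + p.1 * fderiv ℂ (logSum L) p (1, 0)
  set B' := 1 + (chartMap L p).1 * fderiv ℂ (logSum L) (chartMap L p) (1, 0)
  have hW : (c (v, 1)).2 * (deg L * (p.1 * e) ^ (d + 1) * (e * B) * p.1 ^ 3)
      = e' * B' * jac L * (chartMap L p).1 ^ 3 := by
    field_simp at hmain
    linear_combination -hmain
  have hT : ((chartMap L p).1 * e') ^ 3 = (p.1 * e) ^ (2 * d + 2) * (p.1 * e) ^ (d + 4) := by
    rw [hxD]
    ring
  have hne2 : deg L * (p.1 * e) ^ (d + 4) ≠ 0 :=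
    mul_ne_zero hd0 (pow_ne_zero _ (mul_ne_zero hp1 he0))
  obtain ⟨α, hα⟩ : ∃ α, jac L / deg L = α := ⟨_, rfl⟩
  rw [hα]
  rw [div_eq_iff hd0] at hα
  rw [hα] at hW
  rw [mul_div_assoc', mul_div_assoc', div_eq_div_iff hne' hne]
  apply mul_right_cancel₀ hne2
  linear_combination e' ^ 2 * e ^ 2 * hW + B' * α * deg L * e ^ 2 * hT

end IsAttracting

end Henon

/-! ### Construction of the first two steps, with estimates on the curve `w = 0`. -/

namespace Henon

open Filter Asymptotics

/-- The average of `f` over the segment from `(x, 0)` to `(x, w)`. -/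
noncomputable def fiberAverage (f : ℂ × ℂ → ℂ) (q : ℂ × ℂ) : ℂ :=
  ∫ s in (0 : ℝ)..1, f (q.1, s * q.2)

theorem segment_mem_polydisc {ρ : ℝ} {q : ℂ × ℂ} (hq : q ∈ polydisc ρ) {s : ℝ}
    (hs : s ∈ Set.uIcc (0 : ℝ) 1) : ((q.1, (s : ℂ) * q.2) : ℂ × ℂ) ∈ polydisc ρ ∧
      ‖(s : ℂ) * q.2‖ ≤ ‖q.2‖ := by
  rw [Set.uIcc_of_le zero_le_one] at hs
  have : ‖(s : ℂ) * q.2‖ ≤ ‖q.2‖ := by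
    rw [norm_mul, Complex.norm_real, Real.norm_of_nonneg hs.1]
    exact mul_le_of_le_one_left (norm_nonneg _) hs.2
  exact ⟨⟨hq.1, this.trans_lt hq.2⟩, this⟩

theorem differentiableOn_fiberAverage {f : ℂ × ℂ → ℂ} {ρ : ℝ}
    (hf : DifferentiableOn ℂ f (polydisc ρ)) :
    DifferentiableOn ℂ (fiberAverage f) (polydisc ρ) := by
  intro q hq
  refine DifferentiableAt.differentiableWithinAt ?_
  have := differentiableAt_integral_comp_affine (isOpen_polydisc ρ) hf
    (A := fun s => (ContinuousLinearMap.inl ℂ ℂ ℂ).comp (ContinuousLinearMap.fst ℂ ℂ ℂ)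
      + (s : ℂ) • (ContinuousLinearMap.inr ℂ ℂ ℂ).comp (ContinuousLinearMap.snd ℂ ℂ ℂ))
    (b := fun _ => 0) (c := fun _ => 1) (l := 0) (m := 1) (p₀ := q)
    (by fun_prop) continuous_const continuous_const
    (fun s hs => by simpa using (segment_mem_polydisc hq hs).1)
  have e : fiberAverage f = fun p => ∫ s in (0 : ℝ)..1, f (p.1, s * p.2) := rfl
  rw [e]
  simpa using this

theorem norm_fiberAverage_le {f : ℂ × ℂ → ℂ} {ρ K : ℝ} (hK : 0 ≤ K)
    (hf : ∀ q ∈ polydisc ρ, ‖f q‖ ≤ K * (‖q.1‖ * (‖q.1‖ + ‖q.2‖))) {q : ℂ × ℂ}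
    (hq : q ∈ polydisc ρ) : ‖fiberAverage f q‖ ≤ K * (‖q.1‖ * (‖q.1‖ + ‖q.2‖)) := by
  have := intervalIntegral.norm_integral_le_of_norm_le_const (a := 0) (b := 1)
    (f := fun s : ℝ => f (q.1, s * q.2)) (C := K * (‖q.1‖ * (‖q.1‖ + ‖q.2‖))) fun s hs => by
      obtain ⟨h1, h2⟩ := segment_mem_polydisc hq (Set.uIoc_subset_uIcc hs)
      refine (hf _ h1).trans ?_
      gcongr
  simpa [fiberAverage] using this

theorem hasDerivAt_mul_one_add_fiberAverage {f : ℂ × ℂ → ℂ} {ρ : ℝ}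
    (hf : DifferentiableOn ℂ f (polydisc ρ)) {x w : ℂ} (hq : (x, w) ∈ polydisc ρ) :
    HasDerivAt (fun w => w * (1 + fiberAverage f (x, w))) (1 + f (x, w)) w := by
  have h1 : DifferentiableOn ℂ (fun w => f (x, w)) (Metric.ball 0 (8 * ρ)) :=
    hf.comp (by fun_prop) fun z hz => ⟨hq.1, by simpa using hz⟩
  have h2 := hasDerivAt_mul_integral_segment h1 (by simpa using hq.2)
  refine ((hasDerivAt_id w).add h2).congr_of_eventuallyEq (.of_forall fun z => ?_)
  simp [fiberAverage]
  ring

theorem two_le_deg {L : List HenonFactor} (hL : L ≠ []) (hR : AllReduced L) : 2 ≤ deg L := by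
  have := two_mul_deg_tail_le hL hR
  have := deg_pos hR.tail'
  omega

theorem deg_tail_lt {L : List HenonFactor} (hL : L ≠ []) (hR : AllReduced L) :
    deg L.tail < deg L := by
  have := two_mul_deg_tail_le hL hR
  have := deg_pos hR.tail'
  omega

/-- The first two steps can be carried out, and along the curve `w = 0` the resulting function `h`
is approximated by the second coordinate of the germ at infinity. -/
theorem exists_steps {L : List HenonFactor} (hL : L ≠ []) (hR : AllReduced L) :
    ∃ (F₁ : ℂ × ℂ → ℂ × ℂ) (h : ℂ → ℂ), IsStepOne L F₁ ∧ IsStepTwo L F₁ h ∧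
      ∃ τ u v : ℂ → ℂ, (∀ᶠ x in 𝓝[≠] 0, τ x ≠ 0) ∧
        Tendsto (fun x => x / τ x) (𝓝[≠] 0) (𝓝 1) ∧
        (∀ᶠ x in 𝓝[≠] 0, V L (τ x, 0) ≠ 0 ∧
          x ^ deg L = (chartMap L (τ x, 0)).1 * (1 + u x) ∧
          h x = (chartMap L (τ x, 0)).2 * (1 + v x)) ∧
        (fun x => (chartMap L (τ x, 0)).2) =O[𝓝[≠] 0] (fun x => x ^ (deg L - deg L.tail)) ∧
        u =O[𝓝[≠] 0] (fun x => x ^ (2 * deg L - deg L.tail)) ∧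
        v =O[𝓝[≠] 0] (fun x => x ^ (2 * deg L - deg L.tail)) := by
  have hD := two_le_deg hL hR
  have hE := deg_tail_lt hL hR
  have hD0 : deg L ≠ 0 := by omega
  obtain ⟨C, δ, h⟩ := exists_isAttracting hR
  obtain ⟨ε, hε0, hεδ, K, hK, hest⟩ := h.exists_density_estimates hD hE
  have hε := h.mono hε0 hεδ
  have hdens := h.differentiableOn_density hD hE hεδ fun p hp => (hest p hp).1
  obtain ⟨τ, hτ, hτ0, hright, hleft⟩ := hε.exists_inverse hD hE
  set θ : ℂ × ℂ → ℂ × ℂ := fun q => (τ q, q.2) with hθ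
  have hθ0 : θ 0 = 0 := by simp [hθ, hτ0]
  have hθd : ∀ q, DifferentiableAt ℂ τ q → DifferentiableAt ℂ θ q := fun q hq =>
    hq.prodMk differentiableAt_snd
  have hθc : ContinuousAt θ 0 := (hθd 0 hτ.self_of_nhds).continuousAt
  have hθt : Tendsto θ (𝓝 0) (𝓝 0) := by
    have := hθc.tendsto
    rwa [hθ0] at this
  have hcm0 : chartMap L 0 = 0 := by
    have : deg L - deg L.tail ≠ 0 := by omega
    simp [chartMap, hD0, this]
  have hcmt : Tendsto (chartMap L) (𝓝 0) (𝓝 0) := by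
    have := (hε.differentiableOn_chartMap.differentiableAt
      (polydisc_mem_nhds hε0)).continuousAt.tendsto
    rwa [hcm0] at this
  have hbt : Tendsto (bottcher L) (𝓝 0) (𝓝 0) := by
    have h1 := (hε.differentiableOn_bottcherCoord hD hE).differentiableAt (polydisc_mem_nhds hε0)
    have := (h1.prodMk differentiableAt_snd).continuousAt.tendsto
    change Tendsto (bottcher L) (𝓝 0) (𝓝 (bottcher L 0)) at this
    rwa [hε.bottcher_zero hD hE] at this
  set F₁ : ℂ × ℂ → ℂ × ℂ := fun q => bottcher L (chartMap L (θ q)) with hF₁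
  have hF₁t : Tendsto F₁ (𝓝 0) (𝓝 0) := hbt.comp (hcmt.comp hθt)
  obtain ⟨ρ, hρ, hρP⟩ := exists_polydisc_of_eventually
    ((hθt.eventually (polydisc_mem_nhds hε0)).and (hτ.and (hright.and
      ((hcmt.comp hθt).eventually hleft))))
  obtain ⟨σ₁, hσ₁, hσP₁⟩ := exists_polydisc_of_eventually (hF₁t.eventually (polydisc_mem_nhds hρ))
  obtain ⟨σ, hσ, hσρ, hσ1, hσP⟩ : ∃ σ > 0, σ ≤ ρ ∧ σ ≤ 1 ∧ ∀ q ∈ polydisc σ, F₁ q ∈ polydisc ρ :=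
    ⟨min σ₁ (min ρ 1), by positivity, (min_le_right _ _).trans (min_le_left _ _),
      (min_le_right _ _).trans (min_le_right _ _), fun q hq =>
        hσP₁ q (polydisc_mono (min_le_left _ _) hq)⟩
  have hθm : ∀ q ∈ polydisc ρ, θ q ∈ polydisc ε := fun q hq => (hρP q hq).1
  have hθD : ∀ q ∈ polydisc ρ, DifferentiableAt ℂ θ q := fun q hq => hθd q (hρP q hq).2.1
  have hbθ : ∀ q ∈ polydisc ρ, bottcherCoord L (θ q) = q.1 := fun q hq =>
    congrArg Prod.fst (hρP q hq).2.2.1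
  have hF₁fst : ∀ q ∈ polydisc ρ, (F₁ q).1 = q.1 ^ deg L := fun q hq => by
    rw [← hbθ q hq, ← hε.bottcherCoord_chartMap hD hE (hθm q hq)]
    rfl
  have hθF₁ : ∀ q ∈ polydisc ρ, θ (F₁ q) = chartMap L (θ q) := fun q hq => by
    have := (hρP q hq).2.2.2
    exact Prod.ext this rfl
  have hF₁D : ∀ q ∈ polydisc ρ, DifferentiableAt ℂ F₁ q := fun q hq => by
    have h1 := (hε.differentiableOn_chartMap.differentiableAt
      ((isOpen_polydisc ε).mem_nhds (hθm q hq))).comp q (hθD q hq)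
    have h2 := (hε.differentiableOn_bottcherCoord hD hE).differentiableAt
      ((isOpen_polydisc ε).mem_nhds (hε.chartMap_mem hD hE (hθm q hq)))
    exact (h2.comp q h1).prodMk h1.snd
  have hτ_le : ∀ q ∈ polydisc ρ, ‖τ q‖ ≤ 2 * ‖q.1‖ := fun q hq => by
    have h1 := hbθ q hq
    rw [hε.bottcherCoord_eq hD hE (hθm q hq)] at h1
    have h2 := (hest _ (hθm q hq)).2.2.1
    have h3 := norm_sub_norm_le (1 : ℂ) (Complex.exp (logSum L (θ q)))
    rw [norm_one, norm_sub_rev] at h3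
    rw [← h1, norm_mul]
    have h4 : 0 ≤ ‖τ q‖ := norm_nonneg _
    change ‖τ q‖ ≤ 2 * (‖τ q‖ * _)
    nlinarith
  -- the change of coordinates of the second step
  set f : ℂ × ℂ → ℂ := fun q => density L (θ q) - 1 with hf
  have hfD : DifferentiableOn ℂ f (polydisc ρ) := fun q hq =>
    (((hdens.differentiableAt ((isOpen_polydisc ε).mem_nhds (hθm q hq))).comp q
      (hθD q hq)).sub_const 1).differentiableWithinAt
  have hf_le : ∀ q ∈ polydisc ρ, ‖f q‖ ≤ 4 * K * (‖q.1‖ * (‖q.1‖ + ‖q.2‖)) := fun q hq => by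
    refine (hest _ (hθm q hq)).2.1.trans ?_
    have h1 := hτ_le q hq
    have h2 := norm_nonneg q.1
    have h3 := norm_nonneg q.2
    change K * (‖τ q‖ * (‖τ q‖ + ‖q.2‖)) ≤ _
    calc K * (‖τ q‖ * (‖τ q‖ + ‖q.2‖)) ≤ K * (2 * ‖q.1‖ * (2 * ‖q.1‖ + 2 * ‖q.2‖)) := by
          gcongr
          linarith
      _ = _ := by ring
  -- With this choice `w * (1 + ψ)` is the primitive in `w`, zero at `w = 0`, of the density read in
  -- Böttcher coordinates.
  set ψ := fiberAverage f with hψ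
  have hψD : DifferentiableOn ℂ ψ (polydisc ρ) := differentiableOn_fiberAverage hfD
  have hψ_le : ∀ q ∈ polydisc ρ, ‖ψ q‖ ≤ 4 * K * (‖q.1‖ * (‖q.1‖ + ‖q.2‖)) := fun q hq =>
    norm_fiberAverage_le (by positivity) hf_le hq
  set H : ℂ → ℂ := fun x => (F₁ (x, 0)).2 * (1 + ψ (F₁ (x, 0))) with hH
  have hconj : ∀ q ∈ polydisc σ, (F₁ q).2 * (1 + ψ (F₁ q))
      = jac L / deg L * (q.2 * (1 + ψ q)) * q.1 ^ (2 * deg L - 2) + H q.1 := by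
    rintro ⟨x, w⟩ hq
    have hmem : ∀ z ∈ Metric.ball (0 : ℂ) (8 * σ), ((x, z) : ℂ × ℂ) ∈ polydisc σ := fun z hz =>
      ⟨hq.1, by simpa using hz⟩
    -- The conjugacy holds once `G`, the new second coordinate of the image minus the expected
    -- multiple of `y`, is constant on the vertical disc; its value at `z = 0` is then `H x`.
    set G : ℂ → ℂ := fun z => (F₁ (x, z)).2 * (1 + ψ (F₁ (x, z)))
      - jac L / deg L * x ^ (2 * deg L - 2) * (z * (1 + ψ (x, z))) with hG
    have hGd : ∀ z ∈ Metric.ball (0 : ℂ) (8 * σ), HasDerivAt G 0 z := by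
      intro z hz
      have hz' := hmem z hz
      have hzρ := polydisc_mono hσρ hz'
      have hFz := hσP _ hz'
      have hline : HasDerivAt (fun z : ℂ => ((x, z) : ℂ × ℂ)) (0, 1) z :=
        (hasDerivAt_const z x).prodMk (hasDerivAt_id z)
      have hτz : HasDerivAt (fun z : ℂ => τ (x, z)) (fderiv ℂ τ (x, z) (0, 1)) z :=
        ((hρP _ hzρ).2.1.hasFDerivAt).comp_hasDerivAt z hline
      set v := fderiv ℂ τ (x, z) (0, 1)
      have hθz : HasDerivAt (fun z : ℂ => θ (x, z)) (v, 1) z := hτz.prodMk (hasDerivAt_id z)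
      have hcz : HasDerivAt (fun z : ℂ => (F₁ (x, z)).2)
          (fderiv ℂ (chartMap L) (θ (x, z)) (v, 1)).2 z := by
        have h1 := (hε.differentiableOn_chartMap.differentiableAt
          ((isOpen_polydisc ε).mem_nhds (hθm _ hzρ))).hasFDerivAt
        exact (h1.comp_hasDerivAt (f := fun z => θ (x, z)) z hθz).snd
      have hnear : ∀ᶠ z' in 𝓝 z, ((x, z') : ℂ × ℂ) ∈ polydisc ρ := by
        filter_upwards [Metric.isOpen_ball.mem_nhds hz] with z' hz'
        exact polydisc_mono hσρ (hmem z' hz')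
      have h1 := hasDerivAt_mul_one_add_fiberAverage hfD hzρ
      have hF₁eq : F₁ (x, z) = (x ^ deg L, (F₁ (x, z)).2) := Prod.ext (hF₁fst _ hzρ) rfl
      have h2 : HasDerivAt (fun w => w * (1 + fiberAverage f (x ^ deg L, w)))
          (1 + f (F₁ (x, z))) (F₁ (x, z)).2 := by
        have := hasDerivAt_mul_one_add_fiberAverage hfD (x := x ^ deg L) (w := (F₁ (x, z)).2)
          (by rw [← hF₁eq]; exact hFz)
        rwa [← hF₁eq] at this
      have h3 : HasDerivAt (fun z => (F₁ (x, z)).2 * (1 + ψ (F₁ (x, z))))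
          ((1 + f (F₁ (x, z))) * (fderiv ℂ (chartMap L) (θ (x, z)) (v, 1)).2) z := by
        refine (h2.comp z hcz).congr_of_eventuallyEq ?_
        filter_upwards [hnear] with z' hz'
        have : F₁ (x, z') = (x ^ deg L, (F₁ (x, z')).2) := Prod.ext (hF₁fst _ hz') rfl
        simp only [Function.comp_apply, hψ]
        rw [← this]
      refine (h3.sub (h1.const_mul _)).congr_deriv ?_
      have e1 : 1 + f (F₁ (x, z)) = density L (chartMap L (θ (x, z))) := by
        simp only [hf]
        rw [hθF₁ _ hzρ]
        ring
      have e2 : 1 + f (x, z) = density L (θ (x, z)) := by simp [hf]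
      rw [e1, e2]
      -- The density relation needs `t ≠ 0`. On `x = 0` both terms vanish: the line is collapsed to
      -- the origin, and `2 * D - 2 > 0`.
      rcases eq_or_ne x 0 with hx | hx
      · have hzero : ∀ᶠ z' in 𝓝 z, (F₁ (x, z')).2 = 0 := by
          filter_upwards [hnear] with z' hz'
          have h4 := hτ_le _ hz'
          have h5 : τ (x, z') = 0 := by simpa [hx] using h4
          have h6 : deg L - deg L.tail ≠ 0 := by omega
          change (chartMap L (θ (x, z'))).2 = 0
          simp [chartMap, hθ, h5, h6]
        have h7 := hcz.unique ((hasDerivAt_const z (0 : ℂ)).congr_of_eventuallyEq hzero)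
        have h8 : 2 * deg L - 2 ≠ 0 := by omega
        rw [h7, hx]
        simp [h8]
      · have hb := hbθ _ hzρ
        have hp1 : (θ (x, z)).1 ≠ 0 := by
          intro h0
          rw [hε.bottcherCoord_eq hD hE (hθm _ hzρ), h0, zero_mul] at hb
          exact hx hb.symm
        -- The curve `z ↦ θ (x, z)` lies in the level set `x` of the Böttcher coordinate.
        have hv : fderiv ℂ (bottcherCoord L) (θ (x, z)) (v, 1) = 0 := by
          have h4 := ((hε.differentiableOn_bottcherCoord hD hE).differentiableAt
            ((isOpen_polydisc ε).mem_nhds (hθm _ hzρ))).hasFDerivAt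
          refine (h4.comp_hasDerivAt (f := fun z => θ (x, z)) z hθz).unique
            ((hasDerivAt_const z x).congr_of_eventuallyEq ?_)
          filter_upwards [hnear] with z' hz' using hbθ _ hz'
        have h5 := hε.fderiv_chartMap_mul_density hL hR hD hE (hθm _ hzρ) hp1
          (hest _ (hθm _ hzρ)).1 (hest _ (hε.chartMap_mem hD hE (hθm _ hzρ))).1 hv
        rw [hb] at h5
        rw [mul_comm, h5, sub_self]
    have hGconst : G w = G 0 := by
      refine Metric.isOpen_ball.is_const_of_deriv_eq_zero (s := Metric.ball (0 : ℂ) (8 * σ))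
        (convex_ball _ _).isPreconnected
        (fun z hz => (hGd z hz).differentiableAt.differentiableWithinAt)
        (fun z hz => (hGd z hz).deriv) (by simpa using hq.2) (by simpa using hσ)
    simp only [hG] at hGconst
    simp only [hH]
    linear_combination hGconst
  have hx_mem : ∀ x : ℂ, ‖x‖ < σ → ((x, 0) : ℂ × ℂ) ∈ polydisc σ := fun x hx =>
    ⟨hx, by simpa using hσ⟩
  have hnear : ∀ᶠ x in 𝓝[≠] (0 : ℂ), ‖x‖ < σ := by
    refine nhdsWithin_le_nhds ?_
    filter_upwards [Metric.ball_mem_nhds (0 : ℂ) hσ] with x hx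
    simpa using hx
  have hfst_eq : ∀ x : ℂ, ‖x‖ < σ → (τ (x, 0)) * Complex.exp (logSum L (τ (x, 0), 0)) = x := by
    intro x hx
    have hq := polydisc_mono hσρ (hx_mem x hx)
    have := hbθ _ hq
    rwa [hε.bottcherCoord_eq hD hE (hθm _ hq)] at this
  have hτO : (fun x => τ (x, 0)) =O[𝓝[≠] 0] (fun x : ℂ => x) := by
    refine IsBigO.of_bound 2 ?_
    filter_upwards [hnear] with x hx using hτ_le _ (polydisc_mono hσρ (hx_mem x hx))
  have hTO : (fun x => (chartMap L (τ (x, 0), 0)).1) =O[𝓝[≠] 0] (fun x : ℂ => x ^ deg L) := by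
    refine IsBigO.trans (IsBigO.of_bound 2 ?_) (hτO.pow (deg L))
    filter_upwards [hnear] with x hx
    rw [norm_pow]
    exact hε.fst_le _ (hθm _ (polydisc_mono hσρ (hx_mem x hx)))
  have hWO : (fun x => (chartMap L (τ (x, 0), 0)).2) =O[𝓝[≠] 0]
      (fun x : ℂ => x ^ (deg L - deg L.tail)) := by
    refine IsBigO.trans (IsBigO.of_bound 4 ?_) (hτO.pow (deg L - deg L.tail))
    filter_upwards [hnear] with x hx
    rw [norm_pow]
    exact hε.snd_le _ (hθm _ (polydisc_mono hσρ (hx_mem x hx)))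
  have hpow : ∀ m n : ℕ, n ≤ m → (fun x : ℂ => x ^ m) =O[𝓝[≠] 0] (fun x : ℂ => x ^ n) := by
    intro m n hmn
    refine IsBigO.of_bound 1 ?_
    filter_upwards [hnear] with x hx
    rw [one_mul, norm_pow, norm_pow]
    exact pow_le_pow_of_le_one (norm_nonneg _) (hx.le.trans hσ1) hmn
  -- With `E = D_{N-1}`, the image of `(τ, 0)` has second component `O(x ^ (D - E))`, so every error
  -- of type `‖S‖ (‖S‖ + ‖w‖)` is `O(x ^ D * x ^ (D - E))`.
  have hxy : ∀ S : ℂ → ℂ, S =O[𝓝[≠] 0] (fun x : ℂ => x ^ deg L) →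
      (fun x => ‖S x‖ * (‖S x‖ + ‖(chartMap L (τ (x, 0), 0)).2‖)) =O[𝓝[≠] 0]
      (fun x : ℂ => x ^ (2 * deg L - deg L.tail)) := by
    intro S hS
    refine (hS.norm_left.mul ((hS.trans (hpow _ (deg L - deg L.tail) (by omega))).norm_left.add
      hWO.norm_left)).congr_right fun x => ?_
    rw [← pow_add]
    congr 1
    omega
  -- The relative errors: `u` compares the Böttcher coordinate `x ^ D` of the image with its
  -- `t`-coordinate, `v` compares `y` with `w` there.
  refine ⟨F₁, H, ⟨?_, ?_⟩, ⟨?_, ψ, HolomorphicGerm.of_differentiableOn hρ hψD, ?_, ?_⟩,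
    fun x => τ (x, 0), fun x => Complex.exp (logSum L (chartMap L (τ (x, 0), 0))) - 1,
    fun x => ψ (F₁ (x, 0)), ?_, ?_, ?_, hWO, ?_, ?_⟩
  · filter_upwards [polydisc_mem_nhds hρ] with q hq using hF₁D q hq
  · filter_upwards [hleft] with p hp
    have : θ (bottcher L p) = p := Prod.ext hp rfl
    simp only [hF₁, this]
  · have hHd : DifferentiableOn ℂ H (Metric.ball 0 σ) := by
      intro x hx
      refine DifferentiableAt.differentiableWithinAt ?_
      have hq := hx_mem x (by simpa using hx)
      have h1 : DifferentiableAt ℂ (fun x : ℂ => F₁ (x, 0)) x :=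
        DifferentiableAt.comp x (hF₁D _ (polydisc_mono hσρ hq)) (by fun_prop)
      have h2 := (hψD.differentiableAt ((isOpen_polydisc ρ).mem_nhds (hσP _ hq)))
      have h3 : DifferentiableAt ℂ (fun x : ℂ => ψ (F₁ (x, 0))) x :=
        DifferentiableAt.comp (f := fun x : ℂ => F₁ (x, 0)) x h2 h1
      exact h1.snd.mul (h3.const_add 1)
    exact hHd.analyticAt (Metric.ball_mem_nhds 0 hσ)
  · simpa using hψ_le 0 (mem_of_mem_nhds (polydisc_mem_nhds hρ))
  · filter_upwards [polydisc_mem_nhds hσ] with q hq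
    rw [skewMap, hconj q hq, hF₁fst q (polydisc_mono hσρ hq)]
  · filter_upwards [hnear, self_mem_nhdsWithin] with x hx hx0 h0
    have := hfst_eq x hx
    rw [h0, zero_mul] at this
    exact hx0 this.symm
  · have h1 : Tendsto (fun x : ℂ => ((x, 0) : ℂ × ℂ)) (𝓝[≠] 0) (𝓝 0) := by
      refine Tendsto.mono_left ?_ nhdsWithin_le_nhds
      exact Continuous.tendsto' (by fun_prop) _ _ rfl
    have h2 : ContinuousAt (fun p => Complex.exp (logSum L p)) 0 :=
      ((hε.differentiableOn_logSum hD hE).differentiableAt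
        (polydisc_mem_nhds hε0)).cexp.continuousAt
    have h3 : Tendsto (fun x : ℂ => Complex.exp (logSum L (θ (x, 0)))) (𝓝[≠] 0) (𝓝 1) := by
      have := (h2.tendsto.comp hθt).comp h1
      rwa [hε.logSum_eq_zero hD hE hε.zero_mem rfl, Complex.exp_zero] at this
    refine h3.congr' ?_
    filter_upwards [hnear, self_mem_nhdsWithin] with x hx hx0
    have h4 := hfst_eq x hx
    have h5 : τ (x, 0) ≠ 0 := by
      intro h0
      rw [h0, zero_mul] at h4
      exact hx0 h4.symm
    rw [eq_div_iff h5, mul_comm]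
    exact h4
  · filter_upwards [hnear] with x hx
    have hq := polydisc_mono hσρ (hx_mem x hx)
    have hp := hθm _ hq
    refine ⟨hε.V_ne_zero hp, ?_, rfl⟩
    rw [add_sub_cancel]
    have h1 := hε.bottcherCoord_chartMap hD hE hp
    rw [hbθ _ hq, hε.bottcherCoord_eq hD hE (hε.chartMap_mem hD hE hp)] at h1
    exact h1.symm
  · refine IsBigO.trans (IsBigO.of_bound K ?_) (hxy _ hTO)
    filter_upwards [hnear] with x hx
    have hq := polydisc_mono hσρ (hx_mem x hx)
    rw [Real.norm_of_nonneg (by positivity)]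
    exact (hest _ (hε.chartMap_mem hD hE (hθm _ hq))).2.2.2
  · refine IsBigO.trans (IsBigO.of_bound (4 * K) ?_) (hxy _ (isBigO_refl _ _))
    filter_upwards [hnear] with x hx
    have hq := hx_mem x hx
    rw [Real.norm_of_nonneg (by positivity)]
    have := hψ_le _ (hσP _ hq)
    rwa [hF₁fst _ (polydisc_mono hσρ hq)] at this

end Henon

/-! ### Uniqueness of the function `h` of the second step. -/

namespace Henon

open Filter

/-- The derivative of `w ↦ w * (1 + ψ (x, w))`. -/
noncomputable def fiberDeriv (ψ : ℂ × ℂ → ℂ) (q : ℂ × ℂ) : ℂ :=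
  1 + ψ q + q.2 * fderiv ℂ ψ q (0, 1)

theorem hasDerivAt_fiberDeriv {ψ : ℂ × ℂ → ℂ} {x w : ℂ} (hψ : DifferentiableAt ℂ ψ (x, w)) :
    HasDerivAt (fun w => w * (1 + ψ (x, w))) (fiberDeriv ψ (x, w)) w := by
  have hline : HasDerivAt (fun z : ℂ => ((x, z) : ℂ × ℂ)) (0, 1) w :=
    (hasDerivAt_const w x).prodMk (hasDerivAt_id w)
  have h1 := hψ.hasFDerivAt.comp_hasDerivAt w hline
  refine ((hasDerivAt_id w).mul (h1.const_add 1)).congr_deriv ?_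
  simp [fiberDeriv]

theorem continuousAt_fiberDeriv {ψ : ℂ × ℂ → ℂ} (hψ : HolomorphicGerm ψ) :
    ContinuousAt (fiberDeriv ψ) 0 := by
  obtain ⟨δ, hδ, h⟩ := hψ.exists_differentiableOn
  have hU := polydisc_mem_nhds hδ
  have h1 := (h.differentiableAt hU).continuousAt
  have h2 := ((differentiableOn_fderiv_apply (isOpen_polydisc δ) h (0, 1)).differentiableAt
    hU).continuousAt
  exact (continuousAt_const.add h1).add (continuousAt_snd.mul h2)

theorem fiberDeriv_zero {ψ : ℂ × ℂ → ℂ} (hψ : ψ 0 = 0) : fiberDeriv ψ 0 = 1 := by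
  simp [fiberDeriv, hψ]

/-- Differentiating the conjugacy in `w` eliminates `h`, which depends on `x` alone; the first
component of the `w`-derivative of `F` vanishes since `F` maps `x` to `x ^ D`. -/
theorem eventually_fiberDeriv_comp {L : List HenonFactor} {F : ℂ × ℂ → ℂ × ℂ} {h : ℂ → ℂ}
    {ψ : ℂ × ℂ → ℂ} (hF : HolomorphicGerm F) (hF0 : F 0 = 0) (hψ : HolomorphicGerm ψ)
    (hh : AnalyticAt ℂ h 0)
    (heq : ∀ᶠ p in 𝓝 (0 : ℂ × ℂ),
      ((F p).1, (F p).2 * (1 + ψ (F p))) = skewMap L h (p.1, p.2 * (1 + ψ p))) :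
    ∀ᶠ q in 𝓝 (0 : ℂ × ℂ), fiberDeriv ψ (F q) * (fderiv ℂ F q (0, 1)).2
      = jac L / deg L * q.1 ^ (2 * deg L - 2) * fiberDeriv ψ q := by
  have hFt : Tendsto F (𝓝 0) (𝓝 0) := by
    have := hF.self_of_nhds.continuousAt.tendsto
    rwa [hF0] at this
  have hh' : ∀ᶠ q in 𝓝 (0 : ℂ × ℂ), DifferentiableAt ℂ h q.1 :=
    (continuous_fst.tendsto' (0 : ℂ × ℂ) 0 rfl).eventually
      (hh.eventually_analyticAt.mono fun x hx => hx.differentiableAt)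
  filter_upwards [hF, hψ, hFt.eventually hψ, heq.eventually_nhds, hh'] with q hFq hψq hψF heq hhq
  have e1 := hFq.hasFDerivAt
  have e2 := hψF.hasFDerivAt.comp q e1
  have e3 := e1.snd.mul (e2.const_add 1)
  have e4 : HasFDerivAt (fun p : ℂ × ℂ => p.1 ^ deg L) _ q :=
    (hasFDerivAt_fst (𝕜 := ℂ) (p := q)).pow (deg L)
  have e5 := (hasFDerivAt_snd (𝕜 := ℂ) (p := q)).mul (hψq.hasFDerivAt.const_add 1)
  have e6 := hhq.hasFDerivAt.comp q (hasFDerivAt_fst (𝕜 := ℂ) (p := q))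
  have e7 := ((e5.const_mul (jac L / deg L)).mul
    ((hasFDerivAt_fst (𝕜 := ℂ) (p := q)).pow (2 * deg L - 2))).add e6
  have f1 := e1.fst.unique (e4.congr_of_eventuallyEq (heq.mono fun p hp => congrArg Prod.fst hp))
  have f2 := e3.unique (e7.congr_of_eventuallyEq (heq.mono fun p hp => congrArg Prod.snd hp))
  have g1 : (fderiv ℂ F q (0, 1)).1 = 0 := by
    have := congrArg (fun l : (ℂ × ℂ) →L[ℂ] ℂ => l (0, 1)) f1
    simpa using this
  have g2 := congrArg (fun l : (ℂ × ℂ) →L[ℂ] ℂ => l (0, 1)) f2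
  have g3 : fderiv ℂ F q (0, 1) = (fderiv ℂ F q (0, 1)).2 • (0, 1) := by
    ext <;> simp [g1]
  have g4 : fderiv ℂ ψ (F q) (fderiv ℂ F q (0, 1))
      = (fderiv ℂ F q (0, 1)).2 * fderiv ℂ ψ (F q) (0, 1) := by
    conv_lhs => rw [g3]
    rw [map_smul, smul_eq_mul]
  simp [g4] at g2
  rw [fiberDeriv, fiberDeriv]
  linear_combination g2

/-- The function `h` in the second step is unique. -/
theorem stepTwo_eventuallyEq_of_same {L : List HenonFactor} (hL : L ≠ []) (hR : AllReduced L)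
    {F : ℂ × ℂ → ℂ × ℂ} {h h' : ℂ → ℂ} (hF : IsStepOne L F)
    (hh : IsStepTwo L F h) (hh' : IsStepTwo L F h') : h =ᶠ[𝓝 0] h' := by
  have hD := two_le_deg hL hR
  have hE := deg_tail_lt hL hR
  have hD0 : deg L ≠ 0 := by omega
  obtain ⟨C, ε, hε⟩ := exists_isAttracting hR
  obtain ⟨τ, hτ, hτ0, hright, -⟩ := hε.exists_inverse hD hE
  obtain ⟨hFh, hFφ⟩ := hF
  obtain ⟨hha, ψ, hψ, hψ0, heq⟩ := hh
  obtain ⟨hha', ψ', hψ', hψ0', heq'⟩ := hh'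
  have hφ0 := hε.bottcher_zero hD hE
  have hcm0 : chartMap L 0 = 0 := by
    have : deg L - deg L.tail ≠ 0 := by omega
    simp [chartMap, hD0, this]
  have hF0 : F 0 = 0 := by
    have := hFφ.self_of_nhds
    rwa [hcm0, hφ0] at this
  have hFt : Tendsto F (𝓝 0) (𝓝 0) := by
    have := hFh.self_of_nhds.continuousAt.tendsto
    rwa [hF0] at this
  have hφc : ContinuousAt (bottcher L) 0 :=
    (((hε.differentiableOn_bottcherCoord hD hE).differentiableAt
      (polydisc_mem_nhds hε.pos)).prodMk differentiableAt_snd).continuousAt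
  have hφt : Tendsto (bottcher L) (𝓝 0) (𝓝 0) := by
    have := hφc.tendsto
    rwa [hφ0] at this
  have hθt : Tendsto (fun q : ℂ × ℂ => (τ q, q.2)) (𝓝 0) (𝓝 0) := by
    have := (hτ.self_of_nhds.prodMk differentiableAt_snd).continuousAt.tendsto
    simpa [hτ0, ← Prod.zero_eq_mk] using this
  have hφ1 : ∀ p ∈ polydisc ε, p.1 ≠ 0 → (bottcher L p).1 ≠ 0 := fun p hp hp1 => by
    rw [bottcher, hε.bottcherCoord_eq hD hE hp]
    exact mul_ne_zero hp1 (Complex.exp_ne_zero _)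
  have hφ1' : ∀ p : ℂ × ℂ, p.1 = 0 → (bottcher L p).1 = 0 := fun p hp1 => by
    simp [bottcher, bottcherCoord, hp1]
  have hκ := continuousAt_fiberDeriv hψ
  have hκ' := continuousAt_fiberDeriv hψ'
  have hκne : ∀ᶠ q in 𝓝 (0 : ℂ × ℂ), fiberDeriv ψ q ≠ 0 :=
    hκ.eventually_ne (by simp [fiberDeriv_zero hψ0])
  have hκne' : ∀ᶠ q in 𝓝 (0 : ℂ × ℂ), fiberDeriv ψ' q ≠ 0 :=
    hκ'.eventually_ne (by simp [fiberDeriv_zero hψ0'])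
  -- Both fiber derivatives satisfy the same equation, whose factor is nonzero off `x = 0`, so their
  -- ratio is invariant.
  have hinv : ∀ᶠ q in 𝓝 (0 : ℂ × ℂ), q.1 ≠ 0 →
      fiberDeriv ψ (F q) / fiberDeriv ψ' (F q) = fiberDeriv ψ q / fiberDeriv ψ' q := by
    filter_upwards [eventually_fiberDeriv_comp hFh hF0 hψ hha heq,
      eventually_fiberDeriv_comp hFh hF0 hψ' hha' heq', hκne, hκne', hFt.eventually hκne']
      with q h1 h2 h3 h4 h5 hq
    have hc : jac L / deg L * q.1 ^ (2 * deg L - 2) ≠ 0 :=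
      mul_ne_zero (div_ne_zero (jac_ne_zero hR) (by exact_mod_cast hD0)) (pow_ne_zero _ hq)
    have h6 : (fderiv ℂ F q (0, 1)).2 ≠ 0 := by
      intro h0
      rw [h0, mul_zero] at h1
      exact mul_ne_zero hc h3 h1.symm
    rw [div_eq_div_iff h5 h4]
    apply mul_right_cancel₀ h6
    linear_combination fiberDeriv ψ' q * h1 - fiberDeriv ψ q * h2
  -- The ratio is pulled back to `(t, w)`, where the orbits are known to converge to the origin.
  set R : ℂ × ℂ → ℂ := fun p => fiberDeriv ψ (bottcher L p) / fiberDeriv ψ' (bottcher L p) with hRdef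
  have hR0 : Tendsto R (𝓝 0) (𝓝 1) := by
    have h1 := hκ.tendsto.comp hφt
    have h2 := hκ'.tendsto.comp hφt
    rw [fiberDeriv_zero hψ0] at h1
    rw [fiberDeriv_zero hψ0'] at h2
    have h3 := h1.div h2 one_ne_zero
    rwa [div_one] at h3
  obtain ⟨ρ, hρ, hρP⟩ := exists_polydisc_of_eventually
    ((eventually_mem_set.2 (polydisc_mem_nhds hε.pos)).and (hFφ.and (hφt.eventually hinv)))
  have hρ' : IsAttracting L C (min ρ ε) := hε.mono (lt_min hρ hε.pos) (min_le_right _ _)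
  have hstep : ∀ p ∈ polydisc (min ρ ε), p.1 ≠ 0 → R (chartMap L p) = R p := by
    intro p hp hp1
    obtain ⟨h1, h2, h3⟩ := hρP p (polydisc_mono (min_le_left _ _) hp)
    simp only [hRdef]
    rw [← h2]
    exact h3 (hφ1 p h1 hp1)
  have hRone : ∀ p ∈ polydisc (min ρ ε), p.1 ≠ 0 → R p = 1 := by
    intro p hp hp1
    have hit : ∀ n, ((chartMap L)^[n] p).1 ≠ 0 ∧ R ((chartMap L)^[n] p) = R p := by
      intro n
      induction n with
      | zero => exact ⟨hp1, rfl⟩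
      | succ n ih =>
        have hm := hρ'.iterate_mem hD hE hp n
        rw [Function.iterate_succ_apply', hstep _ hm ih.1]
        exact ⟨hρ'.chartMap_fst_ne_zero hm ih.1, ih.2⟩
    refine tendsto_nhds_unique (tendsto_const_nhds.congr fun n => (hit n).2.symm)
      (hR0.comp (hρ'.tendsto_iterate hD hE hp))
  have hκeq : ∀ᶠ q in 𝓝 (0 : ℂ × ℂ), q.1 ≠ 0 → fiberDeriv ψ q = fiberDeriv ψ' q := by
    filter_upwards [hright, hθt.eventually (polydisc_mem_nhds hρ'.pos), hκne'] with q h1 h2 h3 hq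
    have h4 : ((τ q, q.2) : ℂ × ℂ).1 ≠ 0 := by
      intro h0
      have := hφ1' _ h0
      rw [h1] at this
      exact hq this
    have h5 := hRone _ h2 h4
    simp only [hRdef] at h5
    rw [h1, div_eq_one_iff_eq h3] at h5
    exact h5
  obtain ⟨σ, hσ, hσP⟩ := exists_polydisc_of_eventually (hκeq.and (hψ.and hψ'))
  -- Equal derivatives in `w`, and equal value `0` at `w = 0`.
  have hY : ∀ q ∈ polydisc σ, q.1 ≠ 0 → q.2 * (1 + ψ q) = q.2 * (1 + ψ' q) := by
    rintro ⟨x, w⟩ hq hx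
    have hd : ∀ z ∈ Metric.ball (0 : ℂ) (8 * σ),
        HasDerivAt (fun z => z * (1 + ψ (x, z)) - z * (1 + ψ' (x, z))) 0 z := by
      intro z hz
      obtain ⟨h1, h2, h3⟩ := hσP (x, z) ⟨hq.1, by simpa using hz⟩
      refine ((hasDerivAt_fiberDeriv h2).sub (hasDerivAt_fiberDeriv h3)).congr_deriv ?_
      rw [h1 hx, sub_self]
    have hconst := Metric.isOpen_ball.is_const_of_deriv_eq_zero
      (convex_ball (0 : ℂ) (8 * σ)).isPreconnected
      (fun z hz => (hd z hz).differentiableAt.differentiableWithinAt)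
      (fun z hz => (hd z hz).deriv) (x := w) (y := 0) (by simpa using hq.2) (by simpa using hσ)
    simpa [sub_eq_zero] using hconst
  have hx0 : Tendsto (fun x : ℂ => ((x, 0) : ℂ × ℂ)) (𝓝[≠] 0) (𝓝 0) := by
    refine Tendsto.mono_left ?_ nhdsWithin_le_nhds
    exact Continuous.tendsto' (by fun_prop) _ _ rfl
  -- On `w = 0` the conjugacy reads off `h x` as the new second coordinate of `F (x, 0)`; this needs
  -- `x ≠ 0`, and continuity supplies the origin.
  refine (hha.continuousAt.eventuallyEq_nhds_iff_eventuallyEq_nhdsNE hha'.continuousAt).1 ?_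
  filter_upwards [hx0.eventually heq, hx0.eventually heq',
    (hFt.comp hx0).eventually (polydisc_mem_nhds hσ), self_mem_nhdsWithin] with x h1 h2 h3 hx
  have e1 : (F (x, 0)).1 = x ^ deg L := congrArg Prod.fst h1
  have e2 := congrArg Prod.snd h1
  have e3 := congrArg Prod.snd h2
  have e4 := hY (F (x, 0)) h3 (by rw [e1]; exact pow_ne_zero _ hx)
  simp only [skewMap, zero_mul, mul_zero, zero_add] at e2 e3
  rw [← e2, ← e3, e4]

/-- Two germs from the first step coincide, since `φ` has a local right inverse. -/
theorem stepTwo_eventuallyEq {L : List HenonFactor} (hL : L ≠ []) (hR : AllReduced L)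
    {F F' : ℂ × ℂ → ℂ × ℂ} {h h' : ℂ → ℂ} (hF : IsStepOne L F) (hF' : IsStepOne L F')
    (hh : IsStepTwo L F h) (hh' : IsStepTwo L F' h') : h =ᶠ[𝓝 0] h' := by
  have hD := two_le_deg hL hR
  have hE := deg_tail_lt hL hR
  obtain ⟨C, ε, hε⟩ := exists_isAttracting hR
  obtain ⟨τ, hτ, hτ0, hright, -⟩ := hε.exists_inverse hD hE
  have hθt : Tendsto (fun q : ℂ × ℂ => (τ q, q.2)) (𝓝 0) (𝓝 0) := by
    have := (hτ.self_of_nhds.prodMk differentiableAt_snd).continuousAt.tendsto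
    simpa [hτ0, ← Prod.zero_eq_mk] using this
  have hFF' : ∀ᶠ q in 𝓝 0, F' q = F q := by
    filter_upwards [hright, hθt.eventually hF.2, hθt.eventually hF'.2] with q h1 h2 h3
    rw [h1] at h2 h3
    rw [h2, h3]
  obtain ⟨hha', ψ', hψ', hψ0', heq'⟩ := hh'
  refine stepTwo_eventuallyEq_of_same hL hR hF hh ⟨hha', ψ', hψ', hψ0', ?_⟩
  filter_upwards [heq', hFF'] with q h1 h2
  rwa [h2] at h1

end Henon

/-! ### Recovering the factors from pole expansions along `w = 0`. -/

namespace Henon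

open Filter Asymptotics

/-- The homogenization `s ^ d * P (v / s)` of a polynomial of degree `d`. -/
noncomputable def homogenized (P : ℂ[X]) (q : ℂ × ℂ) : ℂ :=
  ∑ k ∈ Finset.range (P.natDegree + 1), P.coeff k * q.1 ^ (P.natDegree - k) * q.2 ^ k

theorem contDiff_homogenized (P : ℂ[X]) : ContDiff ℂ 1 (homogenized P) := by
  unfold homogenized
  fun_prop

theorem pow_mul_eval_eq_homogenized (P : ℂ[X]) (s x : ℂ) :
    s ^ P.natDegree * P.eval x = homogenized P (s, s * x) := by
  rw [homogenized, Polynomial.eval_eq_sum_range, Finset.mul_sum]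
  refine Finset.sum_congr rfl fun k hk => ?_
  obtain ⟨e, he⟩ := Nat.exists_eq_add_of_le (Nat.lt_succ_iff.1 (Finset.mem_range.1 hk))
  simp only [he, Nat.add_sub_cancel_left]
  ring

theorem homogenized_zero_one (P : ℂ[X]) : homogenized P (0, 1) = P.leadingCoeff := by
  rw [homogenized, Finset.sum_range_succ, Finset.sum_eq_zero]
  · simp
  · intro k hk
    have : P.natDegree - k ≠ 0 := by
      have := Finset.mem_range.1 hk
      omega
    simp [this]

theorem tendsto_pow_nhdsNE {n : ℕ} (hn : n ≠ 0) :
    Tendsto (fun x : ℂ => x ^ n) (𝓝[≠] 0) (𝓝 0) := by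
  refine Tendsto.mono_left ?_ nhdsWithin_le_nhds
  exact (continuous_pow n).tendsto' 0 0 (by simp [hn])

theorem isBigO_pow_pow {m n : ℕ} (h : n ≤ m) :
    (fun x : ℂ => x ^ m) =O[𝓝[≠] 0] fun x : ℂ => x ^ n := by
  refine IsBigO.mono (l' := 𝓝 0) (IsBigO.of_bound 1 ?_) nhdsWithin_le_nhds
  filter_upwards [Metric.ball_mem_nhds (0 : ℂ) one_pos] with x hx
  rw [one_mul, norm_pow, norm_pow]
  exact pow_le_pow_of_le_one (norm_nonneg _) (by simpa using (Metric.mem_ball.1 hx).le) h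

theorem tendsto_zero_of_isBigO_pow {f : ℂ → ℂ} {n : ℕ} (hn : n ≠ 0)
    (h : f =O[𝓝[≠] 0] fun x : ℂ => x ^ n) : Tendsto f (𝓝[≠] 0) (𝓝 0) :=
  h.trans_tendsto (tendsto_pow_nhdsNE hn)

theorem isBigO_of_pow_mul {f : ℂ → ℂ} {m n : ℕ}
    (h : (fun x => x ^ n * f x) =O[𝓝[≠] 0] fun x : ℂ => x ^ (n + m)) :
    f =O[𝓝[≠] 0] fun x : ℂ => x ^ m := by
  refine ((isBigO_refl (fun x : ℂ => (x ^ n)⁻¹) _).mul h).congr' ?_ ?_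
  · filter_upwards [self_mem_nhdsWithin] with x hx
    rw [inv_mul_cancel_left₀ (pow_ne_zero n hx)]
  · filter_upwards [self_mem_nhdsWithin] with x hx
    rw [pow_add, inv_mul_cancel_left₀ (pow_ne_zero n hx)]

/-- Two functions with poles of orders `m` and `n` whose difference is small have `m = n`. -/
theorem pole_order_le {f g : ℂ → ℂ} {m n : ℕ}
    (hf : Tendsto (fun x => x ^ m * f x) (𝓝[≠] 0) (𝓝 1))
    (hg : Tendsto (fun x => x ^ n * g x) (𝓝[≠] 0) (𝓝 1))
    (hfg : Tendsto (fun x => x * (f x - g x)) (𝓝[≠] 0) (𝓝 0)) : n ≤ m := by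
  by_contra! hlt
  have h1 : Tendsto (fun x => x ^ (n - m) * (x ^ m * f x) - x ^ (n - 1) * (x * (f x - g x)))
      (𝓝[≠] 0) (𝓝 0) := by
    have h2 := (tendsto_pow_nhdsNE (show n - m ≠ 0 by omega)).mul hf
    have h3 : Tendsto (fun x : ℂ => x ^ (n - 1)) (𝓝[≠] 0) (𝓝 (0 ^ (n - 1))) :=
      Tendsto.mono_left ((continuous_pow _).tendsto 0) nhdsWithin_le_nhds
    simpa using h2.sub (h3.mul hfg)
  have h4 := tendsto_nhds_unique (hg.congr fun x => ?_) h1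
  · exact one_ne_zero h4
  · rw [← mul_assoc, ← mul_assoc, ← pow_add, Nat.sub_add_cancel hlt.le, ← pow_succ,
      Nat.sub_add_cancel (by omega)]
    ring

theorem pole_order_eq {f g : ℂ → ℂ} {m n : ℕ}
    (hf : Tendsto (fun x => x ^ m * f x) (𝓝[≠] 0) (𝓝 1))
    (hg : Tendsto (fun x => x ^ n * g x) (𝓝[≠] 0) (𝓝 1))
    (hfg : Tendsto (fun x => x * (f x - g x)) (𝓝[≠] 0) (𝓝 0)) :
    m = n := by
  refine le_antisymm (pole_order_le hg hf ?_) (pole_order_le hf hg hfg)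
  simpa using (hfg.neg).congr fun x => by ring

/-- Comparison of principal parts. -/
theorem eq_of_principal_parts {f g : ℂ → ℂ} {m n : ℕ} {a b c : ℂ} (ha : a ≠ 0) (hb : b ≠ 0)
    (hm : m ≠ 0) (hn : n ≠ 0)
    (hf : Tendsto (fun x => f x - (x ^ m)⁻¹) (𝓝[≠] 0) (𝓝 0))
    (hg : Tendsto (fun x => g x - (x ^ n)⁻¹) (𝓝[≠] 0) (𝓝 0))
    (h : Tendsto (fun x => a * f x - b * g x) (𝓝[≠] 0) (𝓝 c)) :
    m = n ∧ a = b ∧ c = 0 := by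
  have key : Tendsto (fun x => a * (x ^ m)⁻¹ - b * (x ^ n)⁻¹) (𝓝[≠] 0) (𝓝 c) := by
    have := (h.sub (hf.const_mul a)).add (hg.const_mul b)
    simp only [mul_zero, sub_zero, add_zero] at this
    exact this.congr fun x => by ring
  have aux : ∀ {k l : ℕ} {u v d : ℂ}, v ≠ 0 →
      Tendsto (fun x => u * (x ^ k)⁻¹ - v * (x ^ l)⁻¹) (𝓝[≠] (0 : ℂ)) (𝓝 d) → l ≠ 0 → l ≤ k := by
    intro k l u v d hv hlim hl
    by_contra! hlt
    have h1 := (tendsto_pow_nhdsNE hl).mul hlim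
    have h2 := ((tendsto_pow_nhdsNE (show l - k ≠ 0 by omega)).const_mul u).sub_const v
    rw [zero_mul] at h1
    rw [mul_zero, zero_sub] at h2
    have h3 := tendsto_nhds_unique_of_eventuallyEq h1 h2 (by
      filter_upwards [self_mem_nhdsWithin] with x hx
      have hx0 : x ≠ 0 := hx
      obtain ⟨e, he⟩ := Nat.exists_eq_add_of_lt hlt
      rw [show l - k = e + 1 by omega, he]
      field_simp
      ring)
    exact hv (neg_eq_zero.1 h3.symm)
  have hmn : m = n := by
    refine le_antisymm (aux (u := b) (d := -c) ha ?_ hm) (aux hb key hn)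
    exact key.neg.congr fun x => by ring
  subst hmn
  have h1 := (tendsto_pow_nhdsNE hm).mul key
  rw [zero_mul] at h1
  have hab : a = b := by
    rw [← sub_eq_zero]
    refine tendsto_nhds_unique_of_eventuallyEq tendsto_const_nhds h1 ?_
    filter_upwards [self_mem_nhdsWithin] with x hx
    have hx0 : x ≠ 0 := hx
    field_simp
  refine ⟨rfl, hab, tendsto_nhds_unique key ?_⟩
  simp [hab]

/-- A root of a monic centered polynomial has no constant term. -/
theorem tendsto_sub_pole {P : ℂ[X]} (hd : 2 ≤ P.natDegree) (hP : P.Monic)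
    (hc : P.coeff (P.natDegree - 1) = 0) {f g : ℂ → ℂ} {E : ℕ} (hE : E ≠ 0)
    (hf : Tendsto (fun x => x ^ E * f x) (𝓝[≠] 0) (𝓝 1))
    (hg : Tendsto (fun x => g x - (x ^ (P.natDegree * E))⁻¹) (𝓝[≠] 0) (𝓝 0))
    (hr : Tendsto (fun x => x ^ ((P.natDegree - 1) * E) * (P.eval (f x) - g x)) (𝓝[≠] 0) (𝓝 0)) :
    Tendsto (fun x => f x - (x ^ E)⁻¹) (𝓝[≠] 0) (𝓝 0) := by
  have hred : HenonFactor.IsReduced ⟨P, 1⟩ := ⟨hd, one_ne_zero, hP, hc⟩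
  set d := P.natDegree with hdef
  set B : ℂ × ℂ → ℂ := fun q => ∑ k ∈ Finset.range (d - 1), P.coeff k * q.1 ^ (d - 2 - k) * q.2 ^ k
    with hB
  have hBc : Continuous B := by fun_prop
  have hpair : Tendsto (fun x => ((x ^ E, x ^ E * f x) : ℂ × ℂ)) (𝓝[≠] 0) (𝓝 (0, 1)) :=
    (tendsto_pow_nhdsNE hE).prodMk_nhds hf
  have hBt := (hBc.tendsto (0, 1)).comp hpair
  have hG : Tendsto (fun x => ∑ i ∈ Finset.range d, (x ^ E * f x) ^ i) (𝓝[≠] 0) (𝓝 d) := by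
    have := tendsto_finsetSum (Finset.range d) fun i _ => hf.pow i
    simpa using this
  have hd0 : (d : ℂ) ≠ 0 := by
    have : d ≠ 0 := by omega
    exact_mod_cast this
  -- With `s = x ^ E` and `y = s f`, one has `f - 1 / s = (y ^ d - 1) / (s ∑ y ^ i)`. Centeredness
  -- makes the lower terms of `P` contribute `s ^ 2 B`, so the numerator tends to `0` even after
  -- division by `s`.
  have hnum : Tendsto (fun x => x ^ ((d - 1) * E) * (P.eval (f x) - g x)
      + x ^ ((d - 1) * E) * (g x - (x ^ (d * E))⁻¹) - x ^ E * B (x ^ E, x ^ E * f x))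
      (𝓝[≠] 0) (𝓝 0) := by
    have h1 := (tendsto_pow_nhdsNE (show (d - 1) * E ≠ 0 from
      Nat.mul_ne_zero (by omega) hE)).mul hg
    have h2 := (tendsto_pow_nhdsNE hE).mul hBt
    simpa using (hr.add h1).sub h2
  have hquot := hnum.div hG hd0
  rw [zero_div] at hquot
  refine hquot.congr' ?_
  filter_upwards [self_mem_nhdsWithin, hG.eventually_ne hd0] with x hx hGx
  have hx0 : x ≠ 0 := hx
  have hxE : x ^ E ≠ 0 := pow_ne_zero _ hx0
  simp only [Pi.div_apply]
  rw [div_eq_iff hGx]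
  have e1 := HenonFactor.IsReduced.homogenized_eval hred hxE (x ^ E * f x)
  simp only [← hdef, mul_div_cancel_left₀ _ hxE] at e1
  have e2 := geom_sum_mul (x ^ E * f x) d
  have e3 : (x ^ E) ^ d = x ^ ((d - 1) * E) * x ^ E := by
    rw [← pow_mul, ← pow_add]
    congr 1
    obtain ⟨e, he⟩ := Nat.exists_eq_add_of_le hd
    rw [he, show 2 + e - 1 = e + 1 by omega]
    ring
  have e4 : f x - (x ^ E)⁻¹ = (x ^ E * f x - 1) / x ^ E := by field_simp
  have e5 : x ^ (d * E) = (x ^ E) ^ d := by rw [← pow_mul, mul_comm]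
  have e6 : x ^ ((d - 1) * E) * (x ^ (d * E))⁻¹ = (x ^ E)⁻¹ := by
    rw [e5, e3, mul_inv, mul_inv_cancel_left₀ (pow_ne_zero _ hx0)]
  rw [e4, div_mul_eq_mul_div, mul_comm (x ^ E * f x - 1), e2, eq_div_iff hxE, mul_sub (x ^ ((d - 1) * E)) (g x), e6]
  rw [e3] at e1
  have e7 : (x ^ E)⁻¹ * x ^ E = 1 := inv_mul_cancel₀ hxE
  simp only [hB]
  linear_combination e1 - e7

/-- The polynomial `Q` along a curve `w = 0`. -/
noncomputable def curveQ (τ : ℂ → ℂ) (L : List HenonFactor) (x : ℂ) : ℂ :=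
  ev (1 / τ x, 0) (Q L)

/-- On the curve the product equals `(x / τ) ^ D * V (τ, 0)`, and both factors tend to `1`. -/
theorem tendsto_curveQ {τ : ℂ → ℂ} (hτ : ∀ᶠ x in 𝓝[≠] 0, τ x ≠ 0)
    (hτ1 : Tendsto (fun x => x / τ x) (𝓝[≠] 0) (𝓝 1)) {L : List HenonFactor} (h : AllReduced L) :
    Tendsto (fun x => x ^ deg L * curveQ τ L x) (𝓝[≠] 0) (𝓝 1) := by
  have hτ0 : Tendsto τ (𝓝[≠] 0) (𝓝 0) := by
    have h1 : Tendsto (fun x : ℂ => x) (𝓝[≠] 0) (𝓝 0) := by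
      simpa using tendsto_pow_nhdsNE one_ne_zero
    have h2 := h1.div hτ1 one_ne_zero
    rw [zero_div] at h2
    refine h2.congr' ?_
    filter_upwards [hτ, self_mem_nhdsWithin] with x hx hx0
    have : x ≠ 0 := hx0
    simp only [Pi.div_apply]
    field_simp
  have hV : Tendsto (fun x => V L (τ x, 0)) (𝓝[≠] 0) (𝓝 1) := by
    have h1 : Tendsto (fun x => ((τ x, 0) : ℂ × ℂ)) (𝓝[≠] 0) (𝓝 (0, 0)) :=
      hτ0.prodMk_nhds tendsto_const_nhds
    have := ((differentiable_V L).continuous.tendsto (0, 0)).comp h1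
    rwa [V_zero h] at this
  have := (hτ1.pow (deg L)).mul hV
  rw [one_pow, one_mul] at this
  refine this.congr' ?_
  filter_upwards [hτ] with x hx
  rw [V_eq h hx, curveQ, zero_div, ← mul_assoc, div_pow, div_mul_cancel₀ _ (pow_ne_zero _ hx)]

theorem curveQ_nil (τ : ℂ → ℂ) (x : ℂ) : curveQ τ [] x = 1 / τ x := ev_Q_nil _

/-- The term `a_1 w` drops out on `w = 0`, which is why the Jacobian is needed to recover `a_1`. -/
theorem curveQ_singleton (τ : ℂ → ℂ) (H : HenonFactor) (x : ℂ) :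
    curveQ τ [H] x = H.P.eval (curveQ τ [] x) := by
  rw [curveQ, ev_Q_singleton, curveQ_nil]
  simp

theorem curveQ_cons (τ : ℂ → ℂ) (H H' : HenonFactor) (L : List HenonFactor) (x : ℂ) :
    curveQ τ (H :: H' :: L) x = H.P.eval (curveQ τ (H' :: L) x) - H.a * curveQ τ L x :=
  ev_Q_cons _ _ _ _

/-- `P_N (Q_{N-1}) - Q_N` along a curve has a pole of lower order than `Q_{N-1}`. -/
theorem tendsto_remainder {τ : ℂ → ℂ} (hτ : ∀ᶠ x in 𝓝[≠] 0, τ x ≠ 0)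
    (hτ1 : Tendsto (fun x => x / τ x) (𝓝[≠] 0) (𝓝 1)) {H : HenonFactor} {L : List HenonFactor}
    (h : AllReduced (H :: L)) {n : ℕ} (hn : deg L ≤ n) :
    Tendsto (fun x => x ^ n * (H.P.eval (curveQ τ L x) - curveQ τ (H :: L) x))
      (𝓝[≠] 0) (𝓝 0) := by
  cases L with
  | nil => simp [curveQ_singleton]
  | cons H' L =>
    simp only [curveQ_cons, sub_sub_cancel]
    have h1 := two_mul_deg_tail_le (by simp) h.tail
    have h2 := deg_pos h.tail.tail
    simp only [List.tail_cons] at h1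
    have := ((tendsto_pow_nhdsNE (show n - deg L ≠ 0 by omega)).mul
      (tendsto_curveQ hτ hτ1 h.tail.tail)).const_mul H.a
    simp only [mul_one, mul_zero] at this
    refine this.congr fun x => ?_
    rw [← mul_assoc (x ^ _), ← pow_add, Nat.sub_add_cancel (by omega)]
    ring

/-- Descent from `Q_N` to `Q_{N-1}`: the latter solves `P_N (f) = Q_N` up to a remainder of small
pole order, and roots of centered polynomials acquire no constant term. -/
theorem tendsto_tail_sub_pole {τ : ℂ → ℂ} (hτ : ∀ᶠ x in 𝓝[≠] 0, τ x ≠ 0)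
    (hτ1 : Tendsto (fun x => x / τ x) (𝓝[≠] 0) (𝓝 1)) {H : HenonFactor} {L : List HenonFactor}
    (h : AllReduced (H :: L))
    (hQ : Tendsto (fun x => curveQ τ (H :: L) x - (x ^ deg (H :: L))⁻¹) (𝓝[≠] 0) (𝓝 0)) :
    Tendsto (fun x => curveQ τ L x - (x ^ deg L)⁻¹) (𝓝[≠] 0) (𝓝 0) := by
  rw [deg_cons] at hQ
  refine tendsto_sub_pole h.head.two_le h.head.monic h.head.centered (deg_pos h.tail).ne'
    (tendsto_curveQ hτ hτ1 h.tail) hQ (tendsto_remainder hτ hτ1 h ?_)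
  exact Nat.le_mul_of_pos_left _ (by have := h.head.two_le; omega)

/-- The homogenized polynomial is Lipschitz near `(0, 1)`, so `s ^ d (P f - P g) = O(s (f - g))`
with `s = x ^ E`; dividing by `s ^ d` leaves `x ^ E`. -/
theorem isBigO_eval_sub_eval {P : ℂ[X]} {f g : ℂ → ℂ} {E : ℕ} (hE : E ≠ 0)
    (hf : Tendsto (fun x => x ^ E * f x) (𝓝[≠] 0) (𝓝 1))
    (hg : Tendsto (fun x => x ^ E * g x) (𝓝[≠] 0) (𝓝 1))
    (hfg : (fun x => f x - g x) =O[𝓝[≠] 0] fun x : ℂ => x ^ (P.natDegree * E)) :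
    (fun x => P.eval (f x) - P.eval (g x)) =O[𝓝[≠] 0] fun x : ℂ => x ^ E := by
  have hstrict := ((contDiff_homogenized P).contDiffAt (x := (0, 1))).hasStrictFDerivAt one_ne_zero
  have hpf := (tendsto_pow_nhdsNE hE).prodMk_nhds hf
  have hpg := (tendsto_pow_nhdsNE hE).prodMk_nhds hg
  have h1 := hstrict.isBigO_sub.comp_tendsto (hpf.prodMk_nhds hpg)
  have h2 : (fun x : ℂ => (((x ^ E, x ^ E * f x) : ℂ × ℂ) - (x ^ E, x ^ E * g x)))
      =O[𝓝[≠] 0] fun x : ℂ => x ^ (P.natDegree * E + E) := by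
    have h3 : (fun x : ℂ => x ^ E * (f x - g x)) =O[𝓝[≠] 0]
        fun x : ℂ => x ^ (P.natDegree * E + E) :=
      ((isBigO_refl (fun x : ℂ => x ^ E) _).mul hfg).congr_right fun x => by ring
    refine IsBigO.prod_left (f' := fun x : ℂ => x ^ E - x ^ E)
      (g' := fun x : ℂ => x ^ E * f x - x ^ E * g x) ?_ ?_
    · simpa using isBigO_zero _ _
    · exact h3.congr_left fun x => by ring
  refine isBigO_of_pow_mul (n := P.natDegree * E) ((h1.trans h2).congr' ?_ EventuallyEq.rfl)
  filter_upwards [self_mem_nhdsWithin] with x hx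
  simp only [Function.comp_apply]
  rw [← pow_mul_eval_eq_homogenized P, ← pow_mul_eval_eq_homogenized P, ← pow_mul,
    mul_comm E]
  ring

/-- Otherwise `R (f)` would have a pole of order `R.natDegree * E ≥ E`, its coefficient being the
leading one of `R`. -/
theorem natDegree_eq_zero_of_tendsto {R : ℂ[X]} {f : ℂ → ℂ} {E : ℕ} (hE : E ≠ 0)
    (hf : Tendsto (fun x => x ^ E * f x) (𝓝[≠] 0) (𝓝 1))
    (hR : Tendsto (fun x => x ^ E * R.eval (f x)) (𝓝[≠] 0) (𝓝 0)) : R.natDegree = 0 := by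
  by_contra hne
  have h1 := ((contDiff_homogenized R).continuous.tendsto (0, 1)).comp
    ((tendsto_pow_nhdsNE hE).prodMk_nhds hf)
  rw [homogenized_zero_one] at h1
  have h2 : Tendsto (fun x : ℂ => (x ^ E) ^ (R.natDegree - 1)) (𝓝[≠] 0)
      (𝓝 (0 ^ (R.natDegree - 1))) := (tendsto_pow_nhdsNE hE).pow _
  have h3 := h2.mul hR
  rw [mul_zero] at h3
  have h4 := tendsto_nhds_unique_of_eventuallyEq h1 h3 (by
    filter_upwards [self_mem_nhdsWithin] with x hx
    simp only [Function.comp_apply]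
    rw [← pow_mul_eval_eq_homogenized R, ← mul_assoc, ← pow_succ,
      Nat.sub_add_cancel (Nat.one_le_iff_ne_zero.2 hne)])
  rw [Polynomial.leadingCoeff_eq_zero] at h4
  simp [h4] at hne

/-- A list of reduced factors is determined by the asymptotic behaviour of `Q_N` and `Q_{N-1}`
along a curve, together with the Jacobian determinant. -/
theorem eq_of_curveQ {τ τ' : ℂ → ℂ} (hτ : ∀ᶠ x in 𝓝[≠] 0, τ x ≠ 0)
    (hτ1 : Tendsto (fun x => x / τ x) (𝓝[≠] 0) (𝓝 1)) (hτ' : ∀ᶠ x in 𝓝[≠] 0, τ' x ≠ 0)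
    (hτ1' : Tendsto (fun x => x / τ' x) (𝓝[≠] 0) (𝓝 1)) {L L' : List HenonFactor}
    (hL : L ≠ []) (hL' : L' ≠ []) (hR : AllReduced L) (hR' : AllReduced L')
    (hQ : Tendsto (fun x => curveQ τ L x - (x ^ deg L)⁻¹) (𝓝[≠] 0) (𝓝 0))
    (hQ' : Tendsto (fun x => curveQ τ' L' x - (x ^ deg L')⁻¹) (𝓝[≠] 0) (𝓝 0))
    (hQQ : (fun x => curveQ τ L x - curveQ τ' L' x) =O[𝓝[≠] 0] fun x : ℂ => x ^ deg L.tail)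
    (hTT : (fun x => curveQ τ L.tail x - curveQ τ' L'.tail x) =O[𝓝[≠] 0] fun x : ℂ => x ^ deg L)
    (hjac : jac L = jac L') : L = L' := by
  induction L generalizing L' with
  | nil => exact absurd rfl hL
  | cons H M ih =>
    cases L' with
    | nil => exact absurd rfl hL'
    | cons H' M' =>
    simp only [List.tail_cons] at hQQ hTT
    have hx : Tendsto (fun x : ℂ => x) (𝓝[≠] 0) (𝓝 0) := by
      simpa using tendsto_pow_nhdsNE one_ne_zero
    have hE0 := (deg_pos hR.tail).ne'
    have hE : deg M = deg M' := by
      refine pole_order_eq (tendsto_curveQ hτ hτ1 hR.tail) (tendsto_curveQ hτ' hτ1' hR'.tail) ?_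
      simpa using hx.mul (tendsto_zero_of_isBigO_pow (deg_pos hR).ne' hTT)
    have hD : deg (H :: M) = deg (H' :: M') := by
      refine pole_order_eq (tendsto_curveQ hτ hτ1 hR) (tendsto_curveQ hτ' hτ1' hR') ?_
      simpa using hx.mul (tendsto_zero_of_isBigO_pow hE0 hQQ)
    have hf := tendsto_curveQ hτ hτ1 hR.tail
    have hf' := tendsto_curveQ hτ' hτ1' hR'.tail
    have hr := tendsto_remainder hτ hτ1 hR le_rfl
    have hr' := tendsto_remainder hτ' hτ1' hR' le_rfl
    rw [← hE] at hf' hr'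
    have hPP : (fun x => H'.P.eval (curveQ τ M x) - H'.P.eval (curveQ τ' M' x))
        =O[𝓝[≠] 0] fun x : ℂ => x ^ deg M := by
      refine isBigO_eval_sub_eval hE0 hf hf' ?_
      rwa [hE, ← deg_cons, ← hD]
    -- the difference of the two polynomials, up to a small error
    have hdiff : (fun x => (H.P - H'.P).eval (curveQ τ M x)
        - ((H.P.eval (curveQ τ M x) - curveQ τ (H :: M) x)
          - (H'.P.eval (curveQ τ' M' x) - curveQ τ' (H' :: M') x)))
        =O[𝓝[≠] 0] fun x : ℂ => x ^ deg M := by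
      refine (hQQ.sub hPP).congr_left fun x => ?_
      rw [Polynomial.eval_sub]
      ring
    have hdiff0 := tendsto_zero_of_isBigO_pow hE0 hdiff
    -- Both remainders have poles of order below `deg M`.
    have hconst : (H.P - H'.P).natDegree = 0 := by
      refine natDegree_eq_zero_of_tendsto hE0 hf ?_
      have h1 := (((tendsto_pow_nhdsNE hE0).mul hdiff0).add hr).sub hr'
      simp only [mul_zero, add_zero, sub_zero] at h1
      exact h1.congr fun x => by ring
    obtain ⟨c, hc⟩ : ∃ c, H.P - H'.P = C c := ⟨_, Polynomial.eq_C_of_natDegree_eq_zero hconst⟩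
    rw [hc] at hdiff hdiff0
    simp only [Polynomial.eval_C] at hdiff hdiff0
    rw [jac_cons, jac_cons] at hjac
    cases M with
    | nil =>
      cases M' with
      | cons K M' =>
        have := two_le_deg (by simp) hR'.tail
        rw [deg_nil] at hE
        omega
      | nil =>
        simp only [curveQ_singleton, sub_self, sub_zero] at hdiff0
        have hc0 : c = 0 := tendsto_nhds_unique tendsto_const_nhds hdiff0
        rw [hc0, C_0, sub_eq_zero] at hc
        simp only [jac, List.map_nil, List.prod_nil, mul_one] at hjac
        congr 1
        cases H
        cases H'
        simp_all
    | cons K M =>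
      cases M' with
      | nil =>
        have := two_le_deg (by simp) hR.tail
        rw [deg_nil] at hE
        omega
      | cons K' M' =>
        have hM := tendsto_tail_sub_pole hτ hτ1 hR hQ
        have hM' := tendsto_tail_sub_pole hτ' hτ1' hR' hQ'
        have hMM := tendsto_tail_sub_pole hτ hτ1 hR.tail hM
        have hMM' := tendsto_tail_sub_pole hτ' hτ1' hR'.tail hM'
        simp only [curveQ_cons τ H, curveQ_cons τ' H', sub_sub_cancel] at hdiff hdiff0
        have hlim : Tendsto (fun x => H.a * curveQ τ M x - H'.a * curveQ τ' M' x)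
            (𝓝[≠] 0) (𝓝 c) := by
          have := hdiff0.const_sub c
          simpa using this
        -- The `Q_{N-2}` are pure poles up to `o(1)`, so the constant `c` has nothing to cancel
        -- against.
        obtain ⟨-, ha, hc0⟩ := eq_of_principal_parts hR.head.a_ne_zero hR'.head.a_ne_zero
          (deg_pos hR.tail.tail).ne' (deg_pos hR'.tail.tail).ne' hMM hMM' hlim
        rw [hc0, C_0, sub_eq_zero] at hc
        rw [← ha] at hjac hdiff
        have hHH : H = H' := by
          cases H
          cases H'
          simp_all
        congr 1
        -- The old bound on the tails more than suffices for the new `Q_N`; the new bound on the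
        -- tails is `hdiff` with `c = 0`, divided by the common `a`.
        refine ih (by simp) (by simp) hR.tail hR'.tail hM hM' ?_ ?_
          (mul_left_cancel₀ hR.head.a_ne_zero hjac)
        · refine hTT.trans (isBigO_pow_pow ?_)
          have h1 := deg_tail_lt (by simp) hR
          have h2 := deg_tail_lt (by simp) hR.tail
          simp only [List.tail_cons] at h1 h2 ⊢
          omega
        · refine (hdiff.const_mul_left (-H.a⁻¹)).congr_left fun x => ?_
          have := hR.head.a_ne_zero
          rw [hc0]
          field_simp
          simp

end Henon

/-! ### Taylor coefficients and order of vanishing. -/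

section Taylor

open Filter Asymptotics

theorem iteratedDeriv_eq_zero_of_isLittleO {f : ℂ → ℂ} (hf : AnalyticAt ℂ f 0) {m : ℕ}
    (h : f =o[𝓝[≠] 0] fun x : ℂ => x ^ m) {n : ℕ} (hn : n ≤ m) : iteratedDeriv n f 0 = 0 := by
  have hord : ((m + 1 : ℕ) : ℕ∞) ≤ analyticOrderAt f 0 := by
    by_contra! hlt
    obtain ⟨k, hk⟩ := ENat.ne_top_iff_exists.1 hlt.ne_top
    rw [← hk, Nat.cast_lt] at hlt
    obtain ⟨g, hg, hg0, hfg⟩ := hf.analyticOrderAt_eq_natCast.1 hk.symm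
    have h1 : (fun x : ℂ => x ^ k) =O[𝓝[≠] 0] f := by
      have hginv : (fun x => (g x)⁻¹) =O[𝓝[≠] 0] fun _ => (1 : ℂ) :=
        ((hg.continuousAt.inv₀ hg0).tendsto.mono_left nhdsWithin_le_nhds).isBigO_one ℂ
      have h2 := hginv.mul (isBigO_refl f (𝓝[≠] 0))
      refine h2.congr' ?_ (.of_forall fun x => one_mul _)
      filter_upwards [nhdsWithin_le_nhds hfg,
        nhdsWithin_le_nhds (hg.continuousAt.eventually_ne hg0)] with x hx hgx
      rw [hx]
      simp only [sub_zero, smul_eq_mul]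
      field_simp
    have h2 : (fun x : ℂ => x ^ m) =O[𝓝[≠] 0] fun x : ℂ => x ^ k :=
      Henon.isBigO_pow_pow (by omega)
    have h3 := (h1.trans_isLittleO h).trans_isBigO h2
    have h4 := isLittleO_irrefl' (f' := fun x : ℂ => x ^ k) (l := 𝓝[≠] 0) (by
      refine Eventually.frequently ?_
      filter_upwards [self_mem_nhdsWithin] with x hx
      exact norm_ne_zero_iff.2 (pow_ne_zero _ hx))
    exact h4 h3
  exact (natCast_le_analyticOrderAt_iff_iteratedDeriv_eq_zero hf).1 hord n (by omega)

theorem isBigO_of_iteratedDeriv_eq_zero {f : ℂ → ℂ} (hf : AnalyticAt ℂ f 0) {m : ℕ}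
    (h : ∀ n < m, iteratedDeriv n f 0 = 0) : f =O[𝓝[≠] 0] fun x : ℂ => x ^ m := by
  obtain ⟨g, hg, hfg⟩ := (natCast_le_analyticOrderAt hf).1
    ((natCast_le_analyticOrderAt_iff_iteratedDeriv_eq_zero hf).2 h)
  have hg1 : g =O[𝓝[≠] 0] fun _ => (1 : ℂ) :=
    (hg.continuousAt.tendsto.mono_left nhdsWithin_le_nhds).isBigO_one ℂ
  refine ((isBigO_refl (fun x : ℂ => x ^ m) _).mul hg1).congr' ?_ (.of_forall fun x => mul_one _)
  filter_upwards [nhdsWithin_le_nhds hfg] with x hx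
  rw [hx]
  simp

end Taylor

/-! ### From the normal form to the asymptotics, and the conclusion. -/

namespace Henon

open Filter Asymptotics

theorem IsReducedList.allReduced {L : List HenonFactor} (h : IsReducedList L) : AllReduced L := h.2

/-- The first two steps, with the asymptotics of the result in terms of `Q_N` and `Q_{N-1}`. -/
theorem exists_steps_asymptotics {L : List HenonFactor} (hL : L ≠ []) (hR : AllReduced L) :
    ∃ (F₁ : ℂ × ℂ → ℂ × ℂ) (h : ℂ → ℂ), IsStepOne L F₁ ∧ IsStepTwo L F₁ h ∧
      ∃ τ : ℂ → ℂ, (∀ᶠ x in 𝓝[≠] 0, τ x ≠ 0) ∧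
        Tendsto (fun x => x / τ x) (𝓝[≠] 0) (𝓝 1) ∧
        (fun x => curveQ τ L x - (x ^ deg L)⁻¹) =O[𝓝[≠] 0] (fun x => x ^ deg L.tail) ∧
        (fun x => h x - x ^ deg L * curveQ τ L.tail x) =O[𝓝[≠] 0]
          (fun x => x ^ (2 * deg L)) := by
  obtain ⟨F₁, h, h1, h2, τ, u, v, hτ, hτ1, heq, hW, hu, hv⟩ := exists_steps hL hR
  have hE := two_mul_deg_tail_le hL hR
  have hfacts : ∀ᶠ x in 𝓝[≠] (0 : ℂ), x ≠ 0 ∧ x ^ deg L * curveQ τ L x = 1 + u x ∧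
      x ^ deg L * curveQ τ L.tail x = (chartMap L (τ x, 0)).2 * (1 + u x) ∧
      h x = (chartMap L (τ x, 0)).2 * (1 + v x) := by
    filter_upwards [hτ, heq, self_mem_nhdsWithin] with x hx ⟨hV, e1, e2⟩ hx0
    have hq : curveQ τ L x ≠ 0 := by
      intro h0
      rw [V_eq hR hx, zero_div] at hV
      rw [curveQ] at h0
      rw [h0, mul_zero] at hV
      exact hV rfl
    have e3 := chartMap_eq hR (deg_tail_lt hL hR).le (p := (τ x, 0)) hx
    rw [zero_div] at e3
    change chartMap L (τ x, 0) = (1 / curveQ τ L x, curveQ τ L.tail x / curveQ τ L x) at e3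
    refine ⟨hx0, ?_, ?_, e2⟩
    · rw [e1, e3]
      field_simp
    · rw [e1, e3]
      field_simp
  refine ⟨F₁, h, h1, h2, τ, hτ, hτ1, ?_, ?_⟩
  -- Here `2 D - E ≥ D + E`, because the last factor has degree at least `2`.
  · refine isBigO_of_pow_mul (n := deg L) (hu.congr' ?_ EventuallyEq.rfl |>.trans
      (isBigO_pow_pow (by omega)))
    filter_upwards [hfacts] with x ⟨hx0, e1, _, _⟩
    rw [mul_sub, e1, mul_inv_cancel₀ (pow_ne_zero _ hx0)]
    ring
  -- The error is `O(x ^ (3 D - 2 E))`, and `3 D - 2 E ≥ 2 D`.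
  · refine ((hW.mul (hv.sub hu)).congr' ?_ EventuallyEq.rfl).trans ?_
    · filter_upwards [hfacts] with x ⟨_, _, e2, e3⟩
      rw [e2, e3]
      ring
    · simp only [← pow_add]
      exact isBigO_pow_pow (by omega)

/-- The Taylor coefficients of `h` of indices `0` and `D_N` vanish. -/
theorem iteratedDeriv_eq_zero_of_asymptotics {L : List HenonFactor} (hL : L ≠ [])
    (hR : AllReduced L) {h τ : ℂ → ℂ} (hh : AnalyticAt ℂ h 0) (hτ : ∀ᶠ x in 𝓝[≠] 0, τ x ≠ 0)
    (hτ1 : Tendsto (fun x => x / τ x) (𝓝[≠] 0) (𝓝 1))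
    (hQ : (fun x => curveQ τ L x - (x ^ deg L)⁻¹) =O[𝓝[≠] 0] (fun x : ℂ => x ^ deg L.tail))
    (hhQ : (fun x => h x - x ^ deg L * curveQ τ L.tail x) =O[𝓝[≠] 0]
          (fun x : ℂ => x ^ (2 * deg L))) :
    iteratedDeriv 0 h 0 = 0 ∧ iteratedDeriv (deg L) h 0 = 0 := by
  have hE := deg_tail_lt hL hR
  have hE0 := deg_pos hR.tail'
  have htail : Tendsto (fun x => curveQ τ L.tail x - (x ^ deg L.tail)⁻¹) (𝓝[≠] 0) (𝓝 0) := by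
    cases L with
    | nil => exact absurd rfl hL
    | cons H L => exact tendsto_tail_sub_pole hτ hτ1 hR (tendsto_zero_of_isBigO_pow hE0.ne' hQ)
  -- The absence of a constant term in `Q_{N-1}` becomes the absence of `x ^ D` in `h`.
  have hlo : (fun x => h x - x ^ (deg L - deg L.tail)) =o[𝓝[≠] 0] fun x : ℂ => x ^ deg L := by
    have h1 : (fun x : ℂ => x ^ (2 * deg L)) =o[𝓝[≠] 0] fun x : ℂ => x ^ deg L := by
      have := (isBigO_refl (fun x : ℂ => x ^ deg L) (𝓝[≠] 0)).mul_isLittleO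
        ((isLittleO_one_iff ℂ).2 (tendsto_pow_nhdsNE (deg_pos hR).ne'))
      refine (this.congr_left fun x => ?_).congr_right fun x => mul_one _
      rw [two_mul, pow_add]
    have h2 := (isBigO_refl (fun x : ℂ => x ^ deg L) (𝓝[≠] 0)).mul_isLittleO
      ((isLittleO_one_iff ℂ).2 htail)
    refine ((hhQ.trans_isLittleO h1).add (h2.congr_right fun x => mul_one _)).congr' ?_
      EventuallyEq.rfl
    filter_upwards [self_mem_nhdsWithin] with x hx
    have hx0 : x ≠ 0 := hx
    have : x ^ deg L * (x ^ deg L.tail)⁻¹ = x ^ (deg L - deg L.tail) := by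
      rw [pow_sub₀ _ hx0 hE.le]
    rw [mul_sub, this]
    ring
  have hpow : AnalyticAt ℂ (fun x : ℂ => x ^ (deg L - deg L.tail)) 0 := by fun_prop
  have key : ∀ n ≤ deg L, n ≠ deg L - deg L.tail → iteratedDeriv n h 0 = 0 := by
    intro n hn hne
    have h3 := iteratedDeriv_eq_zero_of_isLittleO (hh.fun_sub hpow) hlo hn
    rw [iteratedDeriv_fun_sub hh.contDiffAt hpow.contDiffAt] at h3
    rw [iteratedDeriv_fun_pow_zero] at h3
    simpa [hne] using h3
  exact ⟨key 0 (Nat.zero_le _) (by omega), key _ le_rfl (by omega)⟩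

theorem stepThree_congr {L : List HenonFactor} {h h' : ℂ → ℂ} (hh : h =ᶠ[𝓝 0] h') :
    stepThree L h = stepThree L h' := by
  have : taylorCoeff h = taylorCoeff h' := funext fun n => by
    rw [taylorCoeff, taylorCoeff, hh.iteratedDeriv_eq]
  funext x
  simp only [stepThree, this]

open Classical in
/-- The Taylor coefficients that can be read off from the third step. -/
theorem taylorCoeff_of_stepThree_eq {L L' : List HenonFactor} {h h' : ℂ → ℂ}
    (hD2 : 2 ≤ deg L) (hD : deg L = deg L') (hj : jac L = jac L')
    (hjac : jac L ≠ 0) (hg : stepThree L h = stepThree L' h')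
    (h0 : taylorCoeff h 0 = taylorCoeff h' 0)
    (hDc : taylorCoeff h (deg L) = taylorCoeff h' (deg L)) {n : ℕ} (hn : n < 2 * deg L) :
    taylorCoeff h n = taylorCoeff h' n := by
  have hpoly : ∀ (u : ℂ → ℂ), ∃ G : ℂ[X], (∀ x, G.eval x = stepThree L u x) ∧
      (∀ k, 1 ≤ k → k ≤ 2 * deg L - 2 → G.coeff k = taylorCoeff u k
        + if k = deg L then (deg L : ℂ) / jac L * taylorCoeff u (2 * deg L - 1) else 0) := by
    intro u
    refine ⟨(∑ k ∈ Finset.Icc 1 (2 * deg L - 2), C (taylorCoeff u k) * X ^ k)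
      + C ((deg L : ℂ) / jac L * taylorCoeff u (2 * deg L - 1)) * X ^ deg L
      + C (if jac L = (deg L : ℂ) then taylorCoeff u (2 * deg L) else 0) * X ^ (2 * deg L),
      fun x => ?_, fun k hk1 hk2 => ?_⟩
    · simp [stepThree, Polynomial.eval_finsetSum]
    · have e1 : k ≠ 2 * deg L := by omega
      rw [coeff_add, coeff_add, finsetSum_coeff, coeff_C_mul_X_pow, coeff_C_mul_X_pow, if_neg e1,
        add_zero]
      congr 1
      simp only [coeff_C_mul_X_pow]
      rw [Finset.sum_ite_eq, if_pos (Finset.mem_Icc.2 ⟨hk1, hk2⟩)]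
  have hg' : stepThree L' h' = stepThree L h' := by
    funext x
    simp only [stepThree, hD, hj]
  rw [hg'] at hg
  obtain ⟨G, hG, hGc⟩ := hpoly h
  obtain ⟨G', hG', hGc'⟩ := hpoly h'
  have hGG : G = G' := Polynomial.funext fun x => by rw [hG, hG', hg]
  have key : ∀ k, 1 ≤ k → k ≤ 2 * deg L - 2 → _ := fun k hk1 hk2 =>
    (hGc k hk1 hk2).symm.trans ((congrArg (fun G => coeff G k) hGG).trans (hGc' k hk1 hk2))
  rcases Nat.eq_zero_or_pos n with rfl | hn0
  · exact h0
  rcases eq_or_ne n (deg L) with rfl | hne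
  · exact hDc
  rcases Nat.lt_or_ge n (2 * deg L - 1) with hlt | hge
  · have := key n hn0 (by omega)
    simpa [hne] using this
  · obtain rfl : n = 2 * deg L - 1 := by omega
    -- The coefficient of `g` at `D` is `b_D + (D / A) b_{2D-1}`, and `b_D` is already known.
    have := key (deg L) (by omega) (by omega)
    rw [if_pos rfl, if_pos rfl, hDc] at this
    have hc : (deg L : ℂ) / jac L ≠ 0 := by
      have : deg L ≠ 0 := by omega
      exact div_ne_zero (by exact_mod_cast this) hjac
    exact mul_left_cancel₀ hc (add_left_cancel this)

theorem of_skewMap_eq {L L' : List HenonFactor} (hR : AllReduced L) {u u' : ℂ → ℂ}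
    (h : skewMap L u = skewMap L' u') : deg L = deg L' ∧ jac L = jac L' ∧ u = u' := by
  have hD : deg L = deg L' := by
    have := congrArg Prod.fst (congrFun h (2, 0))
    simp only [skewMap] at this
    exact Nat.pow_right_injective le_rfl (by exact_mod_cast this)
  have h2 : ∀ x y, (skewMap L u (x, y)).2 = (skewMap L' u' (x, y)).2 := fun x y => by rw [h]
  have hu : u = u' := funext fun x => by simpa [skewMap] using h2 x 0
  refine ⟨hD, ?_, hu⟩
  have h3 := h2 1 1
  have hD0 : (deg L' : ℂ) ≠ 0 := by
    have := (deg_pos hR).ne'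
    rw [hD] at this
    exact_mod_cast this
  simp only [skewMap, hu, hD, one_pow, mul_one, add_left_inj] at h3
  exact (div_left_inj' hD0).1 h3

/-- The polynomial `Q_N` determines the degree `D_N`. -/
theorem deg_eq_of_Q_eq {L L' : List HenonFactor} (hR : AllReduced L) (hR' : AllReduced L')
    (h : Q L = Q L') : deg L = deg L' := by
  -- The curve `z = 1 / x`, `w = 0` suffices: the degree is the pole order of `Q` along it.
  have hτ : ∀ᶠ x in 𝓝[≠] (0 : ℂ), id x ≠ 0 := by
    filter_upwards [self_mem_nhdsWithin] with x hx using hx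
  have hτ1 : Tendsto (fun x : ℂ => x / id x) (𝓝[≠] 0) (𝓝 1) := by
    refine tendsto_const_nhds.congr' ?_
    filter_upwards [hτ] with x hx using (div_self hx).symm
  have h' : curveQ id L' = curveQ id L := funext fun x => by simp only [curveQ, h]
  have h1 := tendsto_curveQ hτ hτ1 hR'
  rw [h'] at h1
  exact pole_order_eq (tendsto_curveQ hτ hτ1 hR) h1 (by simp)

theorem Q_eq_of_compMap_eq {L L' : List HenonFactor} (hL : L ≠ []) (hL' : L' ≠ [])
    (h : compMap L = compMap L') : Q L = Q L' ∧ Q L.tail = Q L'.tail := by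
  have key : ∀ p, (ev p (Q L), ev p (Q L.tail)) = (ev p (Q L'), ev p (Q L'.tail)) := fun p => by
    rw [← compMap_eq hL, ← compMap_eq hL', h]
  exact ⟨eq_of_forall_ev_eq fun p => congrArg Prod.fst (key p),
    eq_of_forall_ev_eq fun p => congrArg Prod.snd (key p)⟩

theorem jac_eq_of_Q_eq {L L' : List HenonFactor} (hL : L ≠ []) (hL' : L' ≠ [])
    (h : Q L = Q L') (h' : Q L.tail = Q L'.tail) : jac L = jac L' := by
  apply MvPolynomial.C_injective (Fin 2) ℂ
  rw [← jacobian_Q hL, ← jacobian_Q hL', h, h']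

/-- The normal form does not depend on the choices. -/
theorem IsNormalForm.unique {F F₃ F₃' : ℂ × ℂ → ℂ × ℂ} (h : IsNormalForm F F₃)
    (h' : IsNormalForm F F₃') : F₃ = F₃' := by
  obtain ⟨L, F₁, u, hL, hF, h1, h2, rfl⟩ := h
  obtain ⟨L', F₁', u', hL', hF', h1', h2', rfl⟩ := h'
  have hR := hL.allReduced
  have hR' := hL'.allReduced
  obtain ⟨hQ, hQt⟩ := Q_eq_of_compMap_eq hL.1 hL'.1 (hF.trans hF'.symm)
  have hD := deg_eq_of_Q_eq hR hR' hQ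
  have hDt := deg_eq_of_Q_eq hR.tail' hR'.tail' hQt
  have hj := jac_eq_of_Q_eq hL.1 hL'.1 hQ hQt
  have hV : V L = V L' := funext fun p => by simp only [V, hQ, hD]
  have hVt : V L.tail = V L'.tail := funext fun p => by simp only [V, hQt, hDt]
  have hc : chartMap L = chartMap L' := funext fun p => by simp only [chartMap, hV, hVt, hD, hDt]
  have hb : bottcher L = bottcher L' := funext fun p => by
    simp only [bottcher, bottcherCoord, hV, hc, hD]
  have hs : skewMap L = skewMap L' := by
    funext u p
    simp only [skewMap, hD, hj]
  have ht : stepThree L' = stepThree L := by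
    funext u x
    simp only [stepThree, hD, hj]
  have h1L : IsStepOne L F₁' := by
    unfold IsStepOne at h1' ⊢
    rwa [hb, hc]
  have h2L : IsStepTwo L F₁' u' := by
    unfold IsStepTwo at h2' ⊢
    rwa [hs]
  rw [← hs, ht, stepThree_congr (stepTwo_eventuallyEq hL.1 hR h1 h1L h2 h2L)]

theorem exists_isNormalForm {F : ℂ × ℂ → ℂ × ℂ} (h : IsReducedHenon F) :
    ∃ F₃, IsNormalForm F F₃ := by
  obtain ⟨L, hL, hF⟩ := h
  obtain ⟨F₁, u, h1, h2, -⟩ := exists_steps hL.1 hL.2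
  exact ⟨_, L, F₁, u, hL, hF, h1, h2, rfl⟩

/-- The normal form determines the map. -/
theorem IsNormalForm.injective {F G F₃ : ℂ × ℂ → ℂ × ℂ} (h : IsNormalForm F F₃)
    (h' : IsNormalForm G F₃) : F = G := by
  obtain ⟨L, F₁, u, hL, rfl, h1, h2, hF₃⟩ := h
  obtain ⟨L', F₁', u', hL', rfl, h1', h2', hG₃⟩ := h'
  have hR := hL.allReduced
  have hR' := hL'.allReduced
  obtain ⟨hD, hj, hg⟩ := of_skewMap_eq hR (hF₃.symm.trans hG₃)
  obtain ⟨f, v, s1, s2, τ, hτ, hτ1, hQ, hv⟩ := exists_steps_asymptotics hL.1 hR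
  obtain ⟨f', v', s1', s2', τ', hτ', hτ1', hQ', hv'⟩ := exists_steps_asymptotics hL'.1 hR'
  -- Uniqueness in the second step allows replacing the given `u`, `u'` by functions with known
  -- asymptotics.
  rw [stepThree_congr (stepTwo_eventuallyEq hL.1 hR h1 s1 h2 s2),
    stepThree_congr (stepTwo_eventuallyEq hL'.1 hR' h1' s1' h2' s2')] at hg
  obtain ⟨z0, zD⟩ := iteratedDeriv_eq_zero_of_asymptotics hL.1 hR s2.1 hτ hτ1 hQ hv
  obtain ⟨z0', zD'⟩ := iteratedDeriv_eq_zero_of_asymptotics hL'.1 hR' s2'.1 hτ' hτ1' hQ' hv'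
  rw [← hD] at zD'
  have hvv : (fun x => v x - v' x) =O[𝓝[≠] 0] fun x : ℂ => x ^ (2 * deg L) := by
    refine isBigO_of_iteratedDeriv_eq_zero (s2.1.fun_sub s2'.1) fun n hn => ?_
    have := taylorCoeff_of_stepThree_eq (two_le_deg hL.1 hR) hD hj (jac_ne_zero hR) hg
      (by rw [taylorCoeff, taylorCoeff, z0, z0']) (by rw [taylorCoeff, taylorCoeff, zD, zD']) hn
    rw [taylorCoeff, taylorCoeff, div_left_inj' (by exact_mod_cast n.factorial_ne_zero)] at this
    rw [iteratedDeriv_fun_sub s2.1.contDiffAt s2'.1.contDiffAt, this, sub_self]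
  have hTT : (fun x => curveQ τ L.tail x - curveQ τ' L'.tail x) =O[𝓝[≠] 0]
      fun x : ℂ => x ^ deg L := by
    rw [← hD] at hv'
    -- Both `h` equal `x ^ D Q_{N-1}` up to `O(x ^ (2 D))` and agree to that order; divide by `x ^
    -- D`.
    refine isBigO_of_pow_mul (n := deg L) ?_
    rw [← two_mul]
    exact ((hvv.sub hv).add hv').congr_left fun x => by ring
  have hE : deg L.tail = deg L'.tail := by
    refine pole_order_eq (tendsto_curveQ hτ hτ1 hR.tail') (tendsto_curveQ hτ' hτ1' hR'.tail') ?_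
    have hx : Tendsto (fun x : ℂ => x) (𝓝[≠] 0) (𝓝 0) := by
      simpa using tendsto_pow_nhdsNE one_ne_zero
    simpa using hx.mul (tendsto_zero_of_isBigO_pow (deg_pos hR).ne' hTT)
  have hQQ : (fun x => curveQ τ L x - curveQ τ' L' x) =O[𝓝[≠] 0] fun x : ℂ => x ^ deg L.tail := by
    rw [← hE, ← hD] at hQ'
    exact (hQ.sub hQ').congr_left fun x => by ring
  rw [eq_of_curveQ hτ hτ1 hτ' hτ1' hL.1 hL'.1 hR hR'
    (tendsto_zero_of_isBigO_pow (deg_pos hR.tail').ne' hQ)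
    (tendsto_zero_of_isBigO_pow (deg_pos hR'.tail').ne' hQ') hQQ hTT hj]

end Henon

/-- The normal form `F⁽³⁾` exists and is unique for each generalized Hénon map `F` given by monic
and centered polynomials, and the resulting map `F ↦ F⁽³⁾` is injective. -/
theorem proposition4p5 :
    ∃ normalForm : {F : ℂ × ℂ → ℂ × ℂ // Henon.IsReducedHenon F} → (ℂ × ℂ → ℂ × ℂ),
      (∀ (F : {F : ℂ × ℂ → ℂ × ℂ // Henon.IsReducedHenon F}) (F₃ : ℂ × ℂ → ℂ × ℂ),
        Henon.IsNormalForm F F₃ ↔ normalForm F = F₃) ∧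
      Function.Injective normalForm := by
  choose nf hnf using fun F : {F : ℂ × ℂ → ℂ × ℂ // Henon.IsReducedHenon F} =>
    Henon.exists_isNormalForm F.2
  refine ⟨nf, fun F F₃ => ⟨fun h => (hnf F).unique h, fun h => h ▸ hnf F⟩, fun F G h => ?_⟩
  exact Subtype.ext ((hnf F).injective (h ▸ hnf G))
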